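/- **Conventions.** Let $d\in\mathbf N$, and equip $\mathbf R^d$ with the Euclidean norm and Lebesgue measure; $B(x,r)$ is the open Euclidean ball. *Regular sets.* A compactly supported finite Borel measure $\mu$ on $\mathbf R^d$ is Ahlfors–David regular of dimension $\delta\in[0,d]$ on scales $[\alpha,\beta]$ with constant $C_R\ge 1$ if $\mu(I)\le C_R r^\delta$ for every closed axis-parallel cube $I$ of side length $r\in[\alpha,\beta]$ and every closed ball $I$ of radius $r\in[\alpha,\beta]$, and $\mu(I)\ge C_R^{-1}r^\delta$ if moreover $I$ is centered at a point of $\operatorname{supp}\mu$. A set $X\subseteq\mathbf R^d$ is $\delta$-regular on scales $[\alpha,\beta]$ with constant $C_R$ if it is the support of such a measure. *Nonorthogonality.* $(X,Y)$ is nonorthogonal with respect to the dot product with constant $0<c_N\le 1$ on scales from $h$ to $1$ if for all $x_0\in X$, $y_0\in Y$, $r_X,r_Y\in(h,1)$ there are $x_1,x_2\in X\cap B(x_0,r_X)$ and $y_1,y_2\in Y\cap B(y_0,r_Y)$ with $$|x_1\cdot y_1-x_2\cdot y_1-x_1\cdot y_2+x_2\cdot y_2|\ge c_N r_X r_Y .$$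 *Operators.* For $h>0$ put $X_h=X+B(0,h)$, $Y_h=Y+B(0,h)$ and $\mathscr F_hf(\xi)=(2\pi h)^{-d/2}\int_{\mathbf R^d}e^{-ix\cdot\xi/h}f(x)\,dx$. **Statement.** Let $0<\delta,\delta'<d$ and let $C_X,C_Y,c_N,R$ be real numbers. Then there exist $\varepsilon_0>0$ and $C>0$, depending only on $d,\delta,\delta',C_X,C_Y,c_N,R$, such that for every $h\in(0,1]$ and all $X,Y\subseteq\mathbf R^d$ of diameter at most $R$ such that $X$ is $\delta$-regular on scales $[h,1]$ with constant $C_X$, $Y$ is $\delta'$-regular on scales $[h,1]$ with constant $C_Y$, and $(X,Y)$ is nonorthogonal with respect to the dot product with constant $c_N$ on scales from $h$ to $1$, $$\|1_{X_h}\,\mathscr F_h\,1_{Y_h}\|_{L^2(\mathbf R^d)\to L^2(\mathbf R^d)}\le C\,h^{\frac{d-\delta-\delta'}{2}+\varepsilon_0}.$$ In particular, if $X,Y$ are fixed and satisfy these hypotheses for all $h\in(0,1]$ with constants independent of $h$, the bound holds for all $h\in(0,1]$ with fixed $\varepsilon_0$ and $C$. -/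

import Mathlib

open MeasureTheory
open scoped Pointwise ENNReal

noncomputable section

namespace FUP

/-- The Euclidean space `ℝ^d` (with the `ℓ²` norm and Lebesgue measure). -/
abbrev E (d : ℕ) : Type := EuclideanSpace ℝ (Fin d)

/-- The closed (axis-parallel) square box with center `c` and side length `r`. -/
def closedBox {d : ℕ} (c : E d) (r : ℝ) : Set (E d) :=
  {x | ∀ i, |x i - c i| ≤ r / 2}

/-- A compactly supported finite Borel measure `μ` on `ℝ^d` is Ahlfors--David regular of
dimension `δ ∈ [0, d]`, on scales `[α, β]`, with regularity constant `C ≥ 1`. -/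
structure IsADRegularMeasure {d : ℕ} (μ : Measure (E d)) (δ α β C : ℝ) : Prop where
  isFiniteMeasure : IsFiniteMeasure μ
  isCompact_support : IsCompact μ.support
  dim_nonneg : 0 ≤ δ
  dim_le : δ ≤ d
  one_le_const : 1 ≤ C
  box_le : ∀ x : E d, ∀ r : ℝ, α ≤ r → r ≤ β → μ.real (closedBox x r) ≤ C * r ^ δ
  ball_le : ∀ x : E d, ∀ r : ℝ, α ≤ r → r ≤ β → μ.real (Metric.closedBall x r) ≤ C * r ^ δ
  le_box : ∀ x ∈ μ.support, ∀ r : ℝ, α ≤ r → r ≤ β → C⁻¹ * r ^ δ ≤ μ.real (closedBox x r)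
  le_ball : ∀ x ∈ μ.support, ∀ r : ℝ, α ≤ r → r ≤ β →
    C⁻¹ * r ^ δ ≤ μ.real (Metric.closedBall x r)

/-- The set `X` is `δ`-regular on scales `[α, β]` with regularity constant `C`: it is the support
of an Ahlfors--David regular measure with these parameters. -/
def IsADRegularSet {d : ℕ} (X : Set (E d)) (δ α β C : ℝ) : Prop :=
  ∃ μ : Measure (E d), IsADRegularMeasure μ δ α β C ∧ μ.support = X

/-- `(X, Y)` is `Φ`-nonorthogonal with constant `0 < c ≤ 1` from scales `(αX, αY)` to
`(βX, βY)`. -/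
def IsNonorthogonal {d : ℕ} (Φ : E d → E d → ℝ) (X Y : Set (E d))
    (c αX αY βX βY : ℝ) : Prop :=
  0 < c ∧ c ≤ 1 ∧
    ∀ x₀ ∈ X, ∀ y₀ ∈ Y, ∀ rX ∈ Set.Ioo αX βX, ∀ rY ∈ Set.Ioo αY βY,
      ∃ x₁ ∈ X ∩ Metric.ball x₀ rX, ∃ x₂ ∈ X ∩ Metric.ball x₀ rX,
      ∃ y₁ ∈ Y ∩ Metric.ball y₀ rY, ∃ y₂ ∈ Y ∩ Metric.ball y₀ rY,
        c * rX * rY ≤ |Φ x₁ y₁ - Φ x₂ y₁ - Φ x₁ y₂ + Φ x₂ y₂|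

/-- The dot product on `ℝ^d × ℝ^d`. -/
def dot {d : ℕ} (x y : E d) : ℝ := ∑ i, x i * y i

/-- The semiclassical Fourier transform
`f ↦ (2πh)^(-d/2) ∫ exp(-i x·ξ / h) f(x) dx` (for integrable `f`). -/
def semiclassicalFourier {d : ℕ} (h : ℝ) (f : E d → ℂ) (ξ : E d) : ℂ :=
  (((2 * Real.pi * h) ^ (-(d : ℝ) / 2) : ℝ) : ℂ) *
    ∫ x : E d, Complex.exp (-Complex.I * (dot x ξ : ℂ) / (h : ℂ)) * f x

/-- The sumset `X_h = X + B(0, h)`. -/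
def nbhd {d : ℕ} (X : Set (E d)) (h : ℝ) : Set (E d) := X + Metric.ball (0 : E d) h

/-- The operator `1_{X_h} 𝓕_h 1_{Y_h}`.  For bounded `Y` and `f ∈ L²` the function `1_{Y_h} f` is
integrable, so that its Fourier transform is given by the integral. -/
def localizedFourier {d : ℕ} (X Y : Set (E d)) (h : ℝ) (f : E d → ℂ) : E d → ℂ :=
  (nbhd X h).indicator (semiclassicalFourier h ((nbhd Y h).indicator f))

/-- The operator norm `‖T‖_{L² → L²}` of an operator on functions on `ℝ^d`, with value `∞` if `T`
is not bounded on `L²`. -/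
def l2OpNorm {d : ℕ} (T : (E d → ℂ) → (E d → ℂ)) : ℝ≥0∞ :=
  sInf {K : ℝ≥0∞ | ∀ f : E d → ℂ, MemLp f 2 volume →
    eLpNorm (T f) 2 volume ≤ K * eLpNorm f 2 volume}

end FUP

end

/-!
The estimate says that the Hilbert--Schmidt bound `h ^ ((d - δ - δ') / 2)`, which only uses the
volumes of `X_h` and `Y_h`, can be improved by a power of `h`. The argument is Dolgopyat's method,
run on finite trees of points of `X` and `Y`.

Both sets are organised in trees of nets with a large ratio `L` between consecutive scales,
weighted by the regular measures (`IsADRegularMeasure.exists_regularTree`); regularity makes every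
child carry a fixed proportion of the weight of its parent. After cutting `Y_h` into cells around
the finest nodes, `𝓕_h (1_{Y_h} f)` is a superposition of waves `exp (-i x·q / h)` with amplitudes
that vary slowly in `x` (`l2OpNorm_localizedFourier_le`). The waves are regrouped along the tree
of `Y`, from fine to coarse. The amplitude belonging to a node of scale `σ` is nearly constant at
scale `κ h / σ`, so at each such step the tree of `X` is descended by one level. The control kept
on an amplitude is a bound `M` on its supremum on a ball together with a proportional bound on its
Lipschitz constant; the change of scale improves the Lipschitz part by itself
(`AmplitudeBound.sum_wave`), so that no constant is lost in a step.

The gain in a step comes from nonorthogonality. It provides children `b₁, b₂` of a node of `Y` and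
children `a₁, a₂` of a node of `X` such that the phase difference of the waves of `b₁` and `b₂`
changes by a definite amount, less than a full turn, between `a₁` and `a₂`. The two waves therefore
cannot add up constructively near both (`norm_wave_mul_sub_le_of_large`, `exists_child_with_loss`),
and the strict loss at one child improves Cauchy--Schwarz by a constant factor, unless the bounds
are so unevenly distributed that Cauchy--Schwarz is not sharp anyway
(`weighted_cauchySchwarz_gain`). The factors multiply over about `log (1 / h)` scales to a power
of `h` (`exists_bounds_at_level`, `exists_bound_of_small`). For `h` bounded below the volume bound
suffices.
-/

namespace FUP

/-! ### Waves, interference of two amplitudes, and a weighted Cauchy--Schwarz inequality -/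

theorem dot_eq_inner {d : ℕ} (x y : E d) : dot x y = inner ℝ x y := by
  simp [dot, PiLp.inner_apply, mul_comm]

/-- The unimodular wave `x ↦ exp (-i x·v / h)` of frequency `v`. -/
noncomputable def wave {d : ℕ} (h : ℝ) (v x : E d) : ℂ :=
  Complex.exp (Complex.I * ((-(inner ℝ x v / h) : ℝ) : ℂ))

theorem norm_wave {d : ℕ} (h : ℝ) (v x : E d) : ‖wave h v x‖ = 1 := by
  rw [wave, Complex.norm_exp_I_mul_ofReal]

theorem wave_add {d : ℕ} (h : ℝ) (v w x : E d) : wave h (v + w) x = wave h v x * wave h w x := by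
  rw [wave, wave, wave, ← Complex.exp_add, inner_add_right, ← mul_add, ← Complex.ofReal_add]
  congr 3
  ring

theorem norm_exp_sub_exp (a b : ℝ) :
    ‖Complex.exp (Complex.I * (a : ℂ)) - Complex.exp (Complex.I * (b : ℂ))‖
      = ‖Complex.exp (Complex.I * ((a - b : ℝ) : ℂ)) - 1‖ := by
  have : Complex.exp (Complex.I * (a : ℂ)) - Complex.exp (Complex.I * (b : ℂ))
      = Complex.exp (Complex.I * (b : ℂ)) * (Complex.exp (Complex.I * ((a - b : ℝ) : ℂ)) - 1) := by
    rw [mul_sub, ← Complex.exp_add]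
    push_cast
    ring_nf
  rw [this, norm_mul, Complex.norm_exp_I_mul_ofReal, one_mul]

theorem norm_wave_sub_le {d : ℕ} {h : ℝ} (hh : 0 < h) (v x y : E d) :
    ‖wave h v x - wave h v y‖ ≤ ‖v‖ / h * ‖x - y‖ := by
  rw [wave, wave, norm_exp_sub_exp]
  refine Real.norm_exp_I_mul_ofReal_sub_one_le.trans ?_
  have : -(inner ℝ x v / h) - -(inner ℝ y v / h) = -(inner ℝ (x - y) v / h) := by
    rw [inner_sub_left]; ring
  rw [this, norm_neg, norm_div, Real.norm_of_nonneg hh.le, div_mul_eq_mul_div]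
  gcongr
  exact (norm_inner_le_norm _ _).trans (mul_comm _ _).le

/-- Two pairs of waves decorrelate when the mixed difference of the phase is neither too small
nor too large. -/
theorem le_norm_wave_mul_sub {d : ℕ} {h : ℝ} (hh : 0 < h) (b₁ b₂ x₁ x₂ : E d)
    (hω : |inner ℝ (x₁ - x₂) (b₁ - b₂)| ≤ h) :
    |inner ℝ (x₁ - x₂) (b₁ - b₂)| / h / 2 ≤
      ‖wave h b₁ x₁ * wave h b₂ x₂ - wave h b₁ x₂ * wave h b₂ x₁‖ := by
  rw [wave, wave, wave, wave, ← Complex.exp_add, ← Complex.exp_add, ← mul_add, ← mul_add,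
    ← Complex.ofReal_add, ← Complex.ofReal_add, norm_exp_sub_exp,
    Complex.norm_exp_I_mul_ofReal_sub_one]
  have : (-(inner ℝ x₁ b₁ / h) + -(inner ℝ x₂ b₂ / h) - (-(inner ℝ x₂ b₁ / h) +
      -(inner ℝ x₁ b₂ / h))) = -(inner ℝ (x₁ - x₂) (b₁ - b₂) / h) := by
    rw [inner_sub_left, inner_sub_right, inner_sub_right]; ring
  rw [this]
  set ω := inner ℝ (x₁ - x₂) (b₁ - b₂) with hωd
  have h1 : |ω / h| ≤ 1 := by
    rw [abs_div, abs_of_pos hh, div_le_one hh]; exact hω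
  have h2 : |-(ω / h) / 2| = |ω / h| / 2 := by rw [abs_div, abs_neg]; norm_num
  have h3 := Real.mul_abs_le_abs_sin (x := -(ω / h) / 2) (by
    rw [h2]; linarith [Real.pi_gt_three])
  rw [norm_mul, Real.norm_eq_abs, Real.norm_eq_abs, abs_two]
  have h4 : (1 : ℝ) / 2 ≤ 2 / Real.pi := by
    rw [div_le_div_iff₀ (by norm_num) Real.pi_pos]; linarith [Real.pi_le_four]
  have h5 : |ω| / h = |ω / h| := by rw [abs_div, abs_of_pos hh]
  rw [h5]
  rw [h2] at h3
  nlinarith [abs_nonneg (ω / h)]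

/-- If a sum of two vectors has nearly the largest norm allowed by the bounds on its summands,
then both summands are nearly extremal and, once rescaled by the bounds, nearly equal. -/
theorem near_of_norm_add_large {u v : ℂ} {M₁ M₂ σ : ℝ} (h₁ : 0 < M₁) (h₂ : 0 < M₂) (hσ : 0 ≤ σ)
    (hu : ‖u‖ ≤ 1) (hv : ‖v‖ ≤ 1)
    (hlarge : M₁ + M₂ - σ ^ 2 * min M₁ M₂ < ‖(M₁ : ℂ) * u + (M₂ : ℂ) * v‖) :
    ‖u - v‖ ≤ 2 * σ ∧ 1 - σ ^ 2 ≤ ‖u‖ := by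
  constructor
  · have key : 2 - σ ^ 2 ≤ ‖u + v‖ := by
      rcases le_total M₁ M₂ with h | h
      · rw [min_eq_left h] at hlarge
        have e : (M₁ : ℂ) * u + (M₂ : ℂ) * v = (M₁ : ℂ) * (u + v) + ((M₂ - M₁ : ℝ) : ℂ) * v := by
          push_cast; ring
        have := norm_add_le ((M₁ : ℂ) * (u + v)) (((M₂ - M₁ : ℝ) : ℂ) * v)
        rw [← e, norm_mul, norm_mul, Complex.norm_real, Complex.norm_real,
          Real.norm_of_nonneg h₁.le, Real.norm_of_nonneg (sub_nonneg.2 h)] at this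
        have h3 : (M₂ - M₁) * ‖v‖ ≤ M₂ - M₁ := mul_le_of_le_one_right (sub_nonneg.2 h) hv
        nlinarith
      · rw [min_eq_right h] at hlarge
        have e : (M₁ : ℂ) * u + (M₂ : ℂ) * v = (M₂ : ℂ) * (u + v) + ((M₁ - M₂ : ℝ) : ℂ) * u := by
          push_cast; ring
        have := norm_add_le ((M₂ : ℂ) * (u + v)) (((M₁ - M₂ : ℝ) : ℂ) * u)
        rw [← e, norm_mul, norm_mul, Complex.norm_real, Complex.norm_real,
          Real.norm_of_nonneg h₂.le, Real.norm_of_nonneg (sub_nonneg.2 h)] at this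
        have h3 : (M₁ - M₂) * ‖u‖ ≤ M₁ - M₂ := mul_le_of_le_one_right (sub_nonneg.2 h) hu
        nlinarith
    have hp := parallelogram_law_with_norm ℝ u v
    have hu2 : ‖u‖ * ‖u‖ ≤ 1 := by nlinarith [norm_nonneg u]
    have hv2 : ‖v‖ * ‖v‖ ≤ 1 := by nlinarith [norm_nonneg v]
    apply abs_le_of_sq_le_sq' _ (by positivity) |>.2
    have : ‖u + v‖ * ‖u + v‖ ≥ 4 - 4 * σ ^ 2 := by
      by_cases hs : σ ^ 2 ≤ 2
      · nlinarith [sq_nonneg (σ ^ 2)]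
      · nlinarith [mul_self_nonneg ‖u + v‖]
    nlinarith
  · have := norm_add_le ((M₁ : ℂ) * u) ((M₂ : ℂ) * v)
    rw [norm_mul, norm_mul, Complex.norm_real, Complex.norm_real,
          Real.norm_of_nonneg h₁.le, Real.norm_of_nonneg h₂.le] at this
    have h3 : M₂ * ‖v‖ ≤ M₂ := mul_le_of_le_one_right h₂.le hv
    have h4 : σ ^ 2 * min M₁ M₂ ≤ σ ^ 2 * M₁ := by gcongr; exact min_le_left _ _
    nlinarith

/-- Two slowly varying amplitudes cannot interfere constructively both at `x₁` and at `x₂` when the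
corresponding waves decorrelate. -/
theorem norm_wave_mul_sub_le_of_large {M₁ M₂ σ τ : ℝ} {e₁ e₂ f₁ f₂ G₁ G₂ H₁ H₂ : ℂ}
    (h₁ : 0 ≤ M₁) (h₂ : 0 ≤ M₂) (hσ : 0 ≤ σ) (hσ' : σ ≤ 1 / 2) (hτ : 0 ≤ τ)
    (he₁ : ‖e₁‖ = 1) (he₂ : ‖e₂‖ = 1) (hf₁ : ‖f₁‖ = 1) (hf₂ : ‖f₂‖ = 1)
    (hG₁ : ‖G₁‖ ≤ M₁) (hG₂ : ‖G₂‖ ≤ M₁) (hH₁ : ‖H₁‖ ≤ M₂) (hH₂ : ‖H₂‖ ≤ M₂)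
    (hG : ‖G₁ - G₂‖ ≤ τ * M₁) (hH : ‖H₁ - H₂‖ ≤ τ * M₂)
    (large₁ : M₁ + M₂ - σ ^ 2 * min M₁ M₂ < ‖e₁ * G₁ + f₁ * H₁‖)
    (large₂ : M₁ + M₂ - σ ^ 2 * min M₁ M₂ < ‖e₂ * G₂ + f₂ * H₂‖) :
    ‖e₁ * f₂ - e₂ * f₁‖ ≤ 8 * σ + 4 * τ := by
  have tri : ‖e₁ * G₁ + f₁ * H₁‖ ≤ M₁ + M₂ := by
    refine (norm_add_le _ _).trans ?_
    rw [norm_mul, norm_mul, he₁, hf₁, one_mul, one_mul]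
    gcongr
  have hmin : 0 < min M₁ M₂ := by
    by_contra hc
    have : min M₁ M₂ = 0 := le_antisymm (not_lt.1 hc) (le_min h₁ h₂)
    rw [this] at large₁
    linarith
  have p₁ : 0 < M₁ := lt_of_lt_of_le hmin (min_le_left _ _)
  have p₂ : 0 < M₂ := lt_of_lt_of_le hmin (min_le_right _ _)
  have c₁ : (M₁ : ℂ) ≠ 0 := by exact_mod_cast p₁.ne'
  have c₂ : (M₂ : ℂ) ≠ 0 := by exact_mod_cast p₂.ne'
  -- rescale the amplitudes to the unit disc
  obtain ⟨g₁, rfl⟩ : ∃ g, G₁ = M₁ * g := ⟨G₁ / M₁, by field_simp⟩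
  obtain ⟨g₂, rfl⟩ : ∃ g, G₂ = M₁ * g := ⟨G₂ / M₁, by field_simp⟩
  obtain ⟨k₁, rfl⟩ : ∃ g, H₁ = M₂ * g := ⟨H₁ / M₂, by field_simp⟩
  obtain ⟨k₂, rfl⟩ : ∃ g, H₂ = M₂ * g := ⟨H₂ / M₂, by field_simp⟩
  rw [norm_mul, Complex.norm_real, Real.norm_of_nonneg (by assumption),
    mul_le_iff_le_one_right (by assumption)] at hG₁ hG₂ hH₁ hH₂
  rw [← mul_sub, norm_mul, Complex.norm_real, Real.norm_of_nonneg (by assumption), mul_comm,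
    mul_le_mul_iff_left₀ (by assumption)] at hG hH
  have r₁ := near_of_norm_add_large (u := e₁ * g₁) (v := f₁ * k₁) p₁ p₂ hσ
    (by rw [norm_mul, he₁, one_mul]; exact hG₁) (by rw [norm_mul, hf₁, one_mul]; exact hH₁)
    (by convert large₁ using 2; ring)
  have r₂ := near_of_norm_add_large (u := e₂ * g₂) (v := f₂ * k₂) p₁ p₂ hσ
    (by rw [norm_mul, he₂, one_mul]; exact hG₂) (by rw [norm_mul, hf₂, one_mul]; exact hH₂)
    (by convert large₂ using 2; ring)
  have hg : 3 / 4 ≤ ‖g₁‖ := by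
    have := r₁.2
    rw [norm_mul, he₁, one_mul] at this
    nlinarith
  have split : (e₁ * f₂ - e₂ * f₁) * g₁ = f₂ * (e₁ * g₁ - f₁ * k₁) + f₁ * f₂ * (k₁ - k₂)
      - f₁ * (e₂ * g₂ - f₂ * k₂) - e₂ * f₁ * (g₁ - g₂) := by ring
  have : ‖(e₁ * f₂ - e₂ * f₁) * g₁‖ ≤ 2 * σ + τ + 2 * σ + τ := by
    rw [split]
    refine (norm_sub_le _ _).trans (add_le_add ((norm_sub_le _ _).trans
      (add_le_add ((norm_add_le _ _).trans (add_le_add ?_ ?_)) ?_)) ?_) <;>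
    simp only [norm_mul, he₂, hf₁, hf₂, one_mul]
    exacts [r₁.1, hH, r₂.1, hG]
  rw [norm_mul] at this
  nlinarith [norm_nonneg (e₁ * f₂ - e₂ * f₁)]

/-- The Cauchy--Schwarz inequality `(∑ M)² ≤ (∑ w) ∑ M² / w`, improved when the ratio `M / w` is at
one heavy index at most half of its average. The case `lam = 0` is the plain inequality. -/
theorem sq_sum_le_of_unbalanced {ι : Type*} (s : Finset ι) (w M : ι → ℝ)
    (hw : ∀ b ∈ s, 0 < w b) (hM : ∀ b ∈ s, 0 ≤ M b) {b : ι} (hb : b ∈ s)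
    {lam : ℝ} (hl : 0 ≤ lam) (hbM : lam ≠ 0 → M b ≤ lam * (∑ b ∈ s, M b) / 2)
    (hbr : lam * ∑ b ∈ s, w b ≤ w b) :
    (∑ b ∈ s, M b) ^ 2 * (1 + lam / 4) ≤ (∑ b ∈ s, w b) * ∑ b ∈ s, M b ^ 2 / w b := by
  classical
  set W := ∑ b ∈ s, w b with hW
  set S := ∑ b ∈ s, M b with hS
  set T := ∑ b ∈ s, M b ^ 2 / w b with hT
  have hWpos : 0 < W := Finset.sum_pos hw ⟨b, hb⟩
  have hSnn : 0 ≤ S := Finset.sum_nonneg hM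
  have termwise : ∀ b ∈ s, 2 * M b * (S / W) - w b * (S / W) ^ 2 ≤ M b ^ 2 / w b := by
    intro b hb
    rw [le_div_iff₀ (hw b hb)]
    nlinarith [sq_nonneg (M b - w b * (S / W))]
  have sum_left : ∑ b ∈ s, (2 * M b * (S / W) - w b * (S / W) ^ 2) = S ^ 2 / W := by
    rw [Finset.sum_sub_distrib, ← Finset.sum_mul, ← Finset.sum_mul, ← Finset.mul_sum, ← hS, ← hW]
    field_simp
    ring
  have hwb := hw b hb
  have improved : 2 * M b * (S / W) - w b * (S / W) ^ 2 + lam * S ^ 2 / (4 * W)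
      ≤ M b ^ 2 / w b := by
    rcases eq_or_ne lam 0 with h0 | h0
    · simpa [h0] using termwise b hb
    have hbM := hbM h0
    rw [le_div_iff₀ hwb]
    have a1 : M b ≤ w b * (S / W) / 2 := by
      have : lam * W * (S / W) ≤ w b * (S / W) := by gcongr
      have e : lam * W * (S / W) = lam * S := by field_simp
      linarith
    have a3 : lam * S ^ 2 / (4 * W) * w b ≤ (w b * (S / W)) ^ 2 / 4 := by
      have e : lam * S ^ 2 / (4 * W) * w b = lam * W * (S ^ 2 / (4 * W ^ 2) * w b) := by
        field_simp
      have e' : (w b * (S / W)) ^ 2 / 4 = w b * (S ^ 2 / (4 * W ^ 2) * w b) := by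
        field_simp
      rw [e, e']
      gcongr
    have a2 : (w b * (S / W)) ^ 2 / 4 ≤ (M b - w b * (S / W)) ^ 2 := by
      have h0 : 0 ≤ w b * (S / W) := by positivity
      nlinarith
    nlinarith
  have hT' : S ^ 2 / W + lam * S ^ 2 / (4 * W) ≤ T := by
    rw [← sum_left, hT, ← Finset.add_sum_erase s _ hb,
      ← Finset.add_sum_erase s (fun b => M b ^ 2 / w b) hb]
    have := Finset.sum_le_sum (s := s.erase b)
      (fun c hc => termwise c (Finset.mem_of_mem_erase hc))
    linarith
  have : S ^ 2 / W + lam * S ^ 2 / (4 * W) = S ^ 2 * (1 + lam / 4) / W := by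
    field_simp
  rwa [this, div_le_iff₀' hWpos] at hT'

/-- The Cauchy--Schwarz inequality for a weighted average, with a gain. Either the two terms
`M b₁`, `M b₂` are comparable to the average and the loss `η * min (M b₁) (M b₂)` on a
proportion `lam'` of the mass is noticeable, or `M / w` is far from constant. -/
theorem weighted_cauchySchwarz_gain {ι : Type*} (s : Finset ι) (w M : ι → ℝ)
    (hw : ∀ b ∈ s, 0 < w b) (hM : ∀ b ∈ s, 0 ≤ M b) {b₁ b₂ : ι} (hb₁ : b₁ ∈ s) (hb₂ : b₂ ∈ s)
    {lam lam' η : ℝ} (hl : 0 < lam) (hll : lam ≤ lam') (hl1 : lam' ≤ 1) (hη : 0 ≤ η)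
    (hη' : η ≤ 1 / 4)
    (hr₁ : lam * ∑ b ∈ s, w b ≤ w b₁) (hr₂ : lam * ∑ b ∈ s, w b ≤ w b₂) :
    (1 - lam') * (∑ b ∈ s, M b) ^ 2 + lam' * (∑ b ∈ s, M b - η * min (M b₁) (M b₂)) ^ 2 ≤
      (1 - η * lam ^ 2 / 2) * ((∑ b ∈ s, w b) * ∑ b ∈ s, M b ^ 2 / w b) := by
  have cs := sq_sum_le_of_unbalanced s w M hw hM hb₁ le_rfl (by simp)
    (by rw [zero_mul]; exact (hw _ hb₁).le)
  have unb : ∀ b ∈ s, M b < lam * (∑ b ∈ s, M b) / 2 → lam * ∑ b ∈ s, w b ≤ w b → _ :=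
    fun b hb h h' => sq_sum_le_of_unbalanced s w M hw hM hb hl.le (fun _ => h.le) h'
  have hmS : min (M b₁) (M b₂) ≤ ∑ b ∈ s, M b :=
    (min_le_left _ _).trans (Finset.single_le_sum hM hb₁)
  have hmnn : 0 ≤ min (M b₁) (M b₂) := le_min (hM _ hb₁) (hM _ hb₂)
  rw [zero_div, add_zero, mul_one] at cs
  set S := ∑ b ∈ s, M b
  set Q := (∑ b ∈ s, w b) * ∑ b ∈ s, M b ^ 2 / w b
  have hSnn : 0 ≤ S := hmnn.trans hmS
  have hQ : 0 ≤ Q := (sq_nonneg S).trans cs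
  have hlam1 : lam ≤ 1 := hll.trans hl1
  have hlow : η * min (M b₁) (M b₂) ≤ S := by nlinarith
  by_cases hcase : lam * S / 2 ≤ min (M b₁) (M b₂)
  · generalize min (M b₁) (M b₂) = m at *
    have h1 : (S - η * m) ^ 2 ≤ S ^ 2 * (1 - η * lam / 2) := by
      have a2 : η * (lam * S / 2) * S ≤ η * m * S := by gcongr
      have a3 : 0 ≤ η * m * (S - η * m) := mul_nonneg (mul_nonneg hη hmnn) (sub_nonneg.2 hlow)
      linarith
    have a1 : lam' * (S - η * m) ^ 2 ≤ lam' * (S ^ 2 * (1 - η * lam / 2)) :=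
      mul_le_mul_of_nonneg_left h1 (hl.le.trans hll)
    have a2 : 0 ≤ (lam' - lam) * (η * lam / 2 * S ^ 2) :=
      mul_nonneg (sub_nonneg.2 hll) (by positivity)
    have h2 : (1 - lam') * S ^ 2 + lam' * (S - η * m) ^ 2 ≤ (1 - η * lam ^ 2 / 2) * S ^ 2 := by
      linarith
    refine h2.trans (mul_le_mul_of_nonneg_left cs ?_)
    nlinarith
  · push Not at hcase
    have cs' : S ^ 2 * (1 + lam / 4) ≤ Q := by
      rcases min_lt_iff.1 hcase with h | h
      exacts [unb b₁ hb₁ h hr₁, unb b₂ hb₂ h hr₂]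
    generalize min (M b₁) (M b₂) = m at *
    have a0 : 0 ≤ η * m := mul_nonneg hη hmnn
    have h1 : (S - η * m) ^ 2 ≤ S ^ 2 := pow_le_pow_left₀ (by linarith) (by linarith) 2
    have h2 : (1 - lam') * S ^ 2 + lam' * (S - η * m) ^ 2 ≤ S ^ 2 := by
      have := mul_le_mul_of_nonneg_left h1 (hl.le.trans hll)
      linarith
    have a4 : η * lam ^ 2 / 2 ≤ lam / 8 := by
      have : η * lam ^ 2 ≤ 1 / 4 * (lam * 1) := by
        rw [sq]; gcongr
      linarith
    have a5 : (1 - lam / 8) * Q ≤ (1 - η * lam ^ 2 / 2) * Q :=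
      mul_le_mul_of_nonneg_right (by linarith) hQ
    have a6 : 0 ≤ 1 - lam / 8 := by linarith
    have a7 : S ^ 2 ≤ (1 - lam / 8) * (S ^ 2 * (1 + lam / 4)) := by
      have e : (1 - lam / 8) * (S ^ 2 * (1 + lam / 4))
          = S ^ 2 + S ^ 2 * (lam * (1 - lam / 4)) / 8 := by ring
      have : 0 ≤ S ^ 2 * (lam * (1 - lam / 4)) :=
        mul_nonneg (sq_nonneg S) (mul_nonneg hl.le (by linarith))
      linarith
    exact (h2.trans a7).trans ((mul_le_mul_of_nonneg_left cs' a6).trans a5)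

/-! ### Trees of nets and slowly varying amplitudes -/

/-- A tree of nets of `X`: level `k` is a finite subset `node k` of `X` at scale `t * L ^ k`, and
every node of level `k` has a parent at the coarser level `k + 1`. The weight of a node stands for
the mass of the part of `X` below it; up to level `N` the weight of a node is the sum of the weights
of its children, each of which carries at least the proportion `lam` of it. Every point of `X` near
a node `p` lies near a child of `p`. -/
structure RegularTree {d : ℕ} (X : Set (E d)) (t L lam : ℝ) (N : ℕ) where
  /-- The nodes of level `k`. -/
  node : ℕ → Finset (E d)
  /-- The map from level `k` to level `k + 1`. -/
  parent : ℕ → E d → E d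
  /-- The mass below a node of level `k`. -/
  weight : ℕ → E d → ℝ
  node_subset : ∀ k, ∀ a ∈ node k, a ∈ X
  parent_mem : ∀ k, ∀ a ∈ node k, parent k a ∈ node (k + 1)
  dist_parent : ∀ k, ∀ a ∈ node k, dist a (parent k a) ≤ t * L ^ (k + 1)
  exists_near : ∀ k, ∀ p ∈ node (k + 1), ∀ x ∈ X, dist x p ≤ t * L ^ (k + 1) / 4 →
    ∃ a ∈ node k, parent k a = p ∧ dist x a ≤ t * L ^ k
  weight_pos : ∀ k ≤ N, ∀ a ∈ node k, 0 < weight k a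
  weight_sum : ∀ k < N, ∀ p ∈ node (k + 1),
    weight (k + 1) p = ∑ a ∈ {a ∈ node k | parent k a = p}, weight k a
  weight_ratio : ∀ k < N, ∀ a ∈ node k, lam * weight (k + 1) (parent k a) ≤ weight k a

/-- The children, at level `k`, of a node `p` of level `k + 1`. -/
noncomputable def RegularTree.children {d : ℕ} {X : Set (E d)} {t L lam : ℝ} {N : ℕ}
    (T : RegularTree X t L lam N) (k : ℕ) (p : E d) : Finset (E d) :=
  {a ∈ T.node k | T.parent k a = p}

theorem RegularTree.mem_children {d : ℕ} {X : Set (E d)} {t L lam : ℝ} {N : ℕ}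
    (T : RegularTree X t L lam N) {k : ℕ} {p a : E d} :
    a ∈ T.children k p ↔ a ∈ T.node k ∧ T.parent k a = p := by
  simp [RegularTree.children]

theorem RegularTree.sum_children {d : ℕ} {X : Set (E d)} {t L lam : ℝ} {N : ℕ}
    (T : RegularTree X t L lam N) {V : Type*} [AddCommMonoid V] (k : ℕ) (f : E d → V) :
    ∑ p ∈ T.node (k + 1), ∑ a ∈ T.children k p, f a = ∑ a ∈ T.node k, f a :=
  Finset.sum_fiberwise_of_maps_to (T.parent_mem k) f

/-- The function `G` is on the set `B` bounded by `M` and Lipschitz with constant `Λ * M`. -/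
structure AmplitudeBound {d : ℕ} (G : E d → ℂ) (B : Set (E d)) (Λ M : ℝ) : Prop where
  nonneg : 0 ≤ M
  norm_le : ∀ x ∈ B, ‖G x‖ ≤ M
  lipschitz : ∀ x ∈ B, ∀ y ∈ B, ‖G x - G y‖ ≤ Λ * M * ‖x - y‖

/-- Nonorthogonality survives the passage from points of `X` and `Y` to nearby points `x₁, x₂` and
net points `b₁, b₂`. The points of `X` are taken in a ball of radius `Z / L * t`, that is `Z` times
the next finer scale: `Z` is so large that the main term `16 κ h` dominates the errors,
and `κ` so small that the mixed difference, divided by `h`, stays below `1`. -/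
theorem mixed_difference_bounds {d : ℕ} {h cN κ Z L t s : ℝ} (hc : 0 < cN) (hc1 : cN ≤ 1)
    (hκ : κ = cN / 100) (hZ : Z = 128 / cN) (hL : 16 * Z + 48 ≤ L) (hh : 0 < h)
    (ht : 0 < t) (hs : 0 < s) (hts : t * s = L * (κ * h)) {p q x₁ x₂ x₁' x₂' b₁ b₂ y₁ y₂ : E d}
    (hx₁ : dist x₁' p ≤ Z / L * t) (hx₂ : dist x₂' p ≤ Z / L * t)
    (hy₁ : dist y₁ q ≤ s / 8) (hy₂ : dist y₂ q ≤ s / 8)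
    (hd₁ : dist x₁ x₁' ≤ 3 * (t / L)) (hd₂ : dist x₂ x₂' ≤ 3 * (t / L))
    (hb₁ : dist b₁ y₁ ≤ s / L) (hb₂ : dist b₂ y₂ ≤ s / L)
    (hno : cN * (Z / L * t) * (s / 8) ≤ |inner ℝ (x₁' - x₂') (y₁ - y₂)|) :
    9 * (κ * h) ≤ |inner ℝ (x₁ - x₂) (b₁ - b₂)| ∧ |inner ℝ (x₁ - x₂) (b₁ - b₂)| ≤ h ∧
      ‖x₁ - x₂‖ ≤ (2 * Z + 6) * (t / L) := by
  have hZ128 : 128 ≤ Z := by rw [hZ, le_div_iff₀ hc]; linarith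
  have hcZ : cN * Z = 128 := by rw [hZ]; field_simp
  have hLpos : 0 < L := by linarith
  have hκpos : 0 < κ := by rw [hκ]; positivity
  have hκh : 0 < κ * h := by positivity
  have tl : 0 < t / L := by positivity
  have tri {a b c e : E d} {α β : ℝ} (h1 : dist a b ≤ α) (h2 : dist c e ≤ β) :
      ‖(a - c) - (b - e)‖ ≤ α + β := by
    have : (a - c) - (b - e) = (a - b) - (c - e) := by abel
    rw [this]
    rw [dist_eq_norm] at h1 h2
    exact (norm_sub_le _ _).trans (add_le_add h1 h2)
  have tri' {a b c : E d} {α : ℝ} (h1 : dist a b ≤ α) (h2 : dist c b ≤ α) :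
      ‖a - c‖ ≤ 2 * α := by
    have := tri h1 h2
    rw [sub_self, sub_zero] at this
    linarith
  have hu := tri' hx₁ hx₂
  have hv := tri' hy₁ hy₂
  have hU := tri hd₁ hd₂
  have hV := tri hb₁ hb₂
  have sl : s / L ≤ s / 8 := by gcongr; linarith
  have hVn : ‖b₁ - b₂‖ ≤ s / 2 := by
    have := norm_add_le ((b₁ - b₂) - (y₁ - y₂)) (y₁ - y₂)
    rw [sub_add_cancel] at this
    linarith
  have hUn : ‖x₁ - x₂‖ ≤ (2 * Z + 6) * (t / L) := by
    have := norm_add_le ((x₁ - x₂) - (x₁' - x₂')) (x₁' - x₂')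
    rw [sub_add_cancel] at this
    have e : Z / L * t = Z * (t / L) := by ring
    rw [e] at hu
    linarith
  have tsL : t / L * s = κ * h := by
    rw [div_mul_eq_mul_div, hts]; field_simp
  set u := x₁' - x₂'
  set v := y₁ - y₂
  set U := x₁ - x₂
  set V := b₁ - b₂
  have split : inner ℝ U V = inner ℝ u v + (inner ℝ (U - u) V + inner ℝ u (V - v)) := by
    rw [inner_sub_left U u V, inner_sub_right u V v]; ring
  have main : |inner ℝ u v| ≤ Z / 2 * (κ * h) := by
    refine (abs_real_inner_le_norm u v).trans ((mul_le_mul hu hv (norm_nonneg _)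
      (by positivity)).trans_eq ?_)
    rw [← tsL]; ring
  have main' : 16 * (κ * h) ≤ |inner ℝ u v| := by
    refine le_trans (le_of_eq ?_) hno
    rw [← tsL]
    linear_combination (-(t / L * s) / 8) * hcZ
  have err₁ : |inner ℝ (U - u) V| ≤ 3 * (κ * h) := by
    refine (abs_real_inner_le_norm _ _).trans ((mul_le_mul hU hVn (norm_nonneg _)
      (by positivity)).trans_eq ?_)
    rw [← tsL]; ring
  have err₂ : |inner ℝ u (V - v)| ≤ κ * h := by
    refine (abs_real_inner_le_norm _ _).trans ((mul_le_mul hu hV (norm_nonneg _)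
      (by positivity)).trans ?_)
    have e : 2 * (Z / L * t) * (s / L + s / L) = 4 * Z / L * (κ * h) := by rw [← tsL]; ring
    rw [e]
    refine mul_le_of_le_one_left hκh.le ?_
    rw [div_le_one hLpos]
    linarith
  have err : |inner ℝ (U - u) V + inner ℝ u (V - v)| ≤ 4 * (κ * h) :=
    (abs_add_le _ _).trans (by linarith)
  refine ⟨?_, ?_, hUn⟩
  · rw [split]
    have := abs_sub_abs_le_abs_sub (inner ℝ u v) (-(inner ℝ (U - u) V + inner ℝ u (V - v)))
    rw [sub_neg_eq_add, abs_neg] at this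
    linarith
  · rw [split]
    refine (abs_add_le _ _).trans ?_
    have : Z * κ = 128 / 100 := by rw [hκ]; linear_combination hcZ / 100
    have k1 : κ ≤ 1 / 100 := by rw [hκ]; linarith
    have : Z / 2 * (κ * h) = 64 / 100 * h := by linear_combination (h / 2) * this
    nlinarith

/-- A superposition of modulated amplitudes, on a smaller ball: the supremum may be replaced by a
better bound `V`, because the Lipschitz seminorm is in any case improved by the change of scale. -/
theorem AmplitudeBound.sum_wave {d : ℕ} {h κ L t s : ℝ} (hκ : 0 < κ) (hL : 4 ≤ L) (hh : 0 < h)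
    (ht : 0 < t) (hts : t * s = L * (κ * h)) (c : Finset (E d)) (q : E d)
    (hc : ∀ b ∈ c, ‖b - q‖ ≤ s) {G : E d → E d → ℂ} {M : E d → ℝ} {B B' : Set (E d)}
    (hB : B' ⊆ B) (hG : ∀ b ∈ c, AmplitudeBound (G b) B (2 * κ / t) (M b)) {V : ℝ}
    (hV : 3 / 4 * ∑ b ∈ c, M b ≤ V)
    (hsup : ∀ x ∈ B', ‖∑ b ∈ c, wave h (b - q) x * G b x‖ ≤ V) :
    AmplitudeBound (fun x => ∑ b ∈ c, wave h (b - q) x * G b x) B' (2 * κ / (t / L)) V where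
  nonneg := le_trans (mul_nonneg (by norm_num) (Finset.sum_nonneg fun b hb => (hG b hb).nonneg)) hV
  norm_le := hsup
  lipschitz x hx y hy := by
    have hLpos : 0 < L := by linarith
    have hsh : s / h = L * κ / t := by
      rw [div_eq_div_iff hh.ne' ht.ne']; linear_combination hts
    have term : ∀ b ∈ c, ‖wave h (b - q) x * G b x - wave h (b - q) y * G b y‖ ≤
        (2 * κ / (t / L) * (3 / 4)) * M b * ‖x - y‖ := by
      intro b hb
      have e : wave h (b - q) x * G b x - wave h (b - q) y * G b y
          = (wave h (b - q) x - wave h (b - q) y) * G b x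
            + wave h (b - q) y * (G b x - G b y) := by ring
      have b1 : ‖wave h (b - q) x - wave h (b - q) y‖ ≤ L * κ / t * ‖x - y‖ := by
        refine (norm_wave_sub_le hh _ _ _).trans ?_
        rw [← hsh]
        gcongr
        exact hc b hb
      have b2 := (hG b hb).norm_le x (hB hx)
      have b3 := (hG b hb).lipschitz x (hB hx) y (hB hy)
      have b4 := (hG b hb).nonneg
      rw [e]
      refine (norm_add_le _ _).trans ?_
      rw [norm_mul, norm_mul, norm_wave, one_mul]
      refine (add_le_add (mul_le_mul b1 b2 (norm_nonneg _) (by positivity)) b3).trans ?_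
      have e1 : L * κ / t * ‖x - y‖ * M b + 2 * κ / t * M b * ‖x - y‖
          = (L + 2) * (κ / t * M b * ‖x - y‖) := by ring
      have e2 : 2 * κ / (t / L) * (3 / 4) * M b * ‖x - y‖
          = (3 / 2 * L) * (κ / t * M b * ‖x - y‖) := by field_simp; ring
      rw [e1, e2]
      gcongr
      linarith
    rw [← Finset.sum_sub_distrib]
    refine (norm_sum_le _ _).trans ((Finset.sum_le_sum term).trans ?_)
    rw [← Finset.sum_mul, ← Finset.mul_sum, mul_assoc (2 * κ / (t / L))]
    gcongr

/-! ### The induction on scales -/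

/-- Destructive interference: if the amplitudes attached to the children of `q` are bounded on
the ball around `p`, then on the ball around some child of `p` their superposition is smaller than
the sum of the bounds, by a definite proportion of two of the bounds. -/
theorem exists_child_with_loss {d : ℕ} {X Y : Set (E d)} {h cN κ Z L t s lam lam' : ℝ} {N N' : ℕ}
    (TX : RegularTree X t L lam N) (TY : RegularTree Y s L lam' N') (hc : 0 < cN) (hc1 : cN ≤ 1)
    (hκ : κ = cN / 100) (hZ : Z = 128 / cN) (hL : 16 * Z + 48 ≤ L) (hh : 0 < h)
    (ht : 0 < t) (hs : 0 < s) (hno : IsNonorthogonal dot X Y cN h h 1 1) {j k : ℕ}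
    (hts : t * L ^ (j + 1) * (s * L ^ (k + 1)) = L * (κ * h))
    (ht' : Z / L * (t * L ^ (j + 1)) ∈ Set.Ioo h 1) (hs' : s * L ^ (k + 1) / 8 ∈ Set.Ioo h 1)
    {p q : E d} (hp : p ∈ TX.node (j + 1)) (hq : q ∈ TY.node (k + 1))
    {G : E d → E d → ℂ} {M : E d → ℝ}
    (hG : ∀ b ∈ TY.children k q, AmplitudeBound (G b)
      (Metric.closedBall p (2 * (t * L ^ (j + 1)))) (2 * κ / (t * L ^ (j + 1))) (M b)) :
    ∃ a ∈ TX.children j p, ∃ b₁ ∈ TY.children k q, ∃ b₂ ∈ TY.children k q,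
      ∀ x ∈ Metric.closedBall a (2 * (t * L ^ j)),
        ‖∑ b ∈ TY.children k q, wave h (b - q) x * G b x‖ ≤
          ∑ b ∈ TY.children k q, M b - (κ / 8) ^ 2 * min (M b₁) (M b₂) := by
  have hZ128 : 128 ≤ Z := by rw [hZ, le_div_iff₀ hc]; linarith
  have hLpos : 0 < L := by linarith
  have hκpos : 0 < κ := by rw [hκ]; positivity
  have hκ1 : κ ≤ 1 / 100 := by rw [hκ]; linarith
  obtain ⟨-, -, hno⟩ := hno
  obtain ⟨x₁', hx₁', x₂', hx₂', y₁, hy₁, y₂, hy₂, hd⟩ :=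
    hno p (TX.node_subset _ p hp) q (TY.node_subset _ q hq) _ ht' _ hs'
  have htj : t * L ^ (j + 1) / L = t * L ^ j := by rw [pow_succ]; field_simp
  have hsk : s * L ^ (k + 1) / L = s * L ^ k := by rw [pow_succ]; field_simp
  set t' := t * L ^ (j + 1)
  set s' := s * L ^ (k + 1)
  have ht'pos : 0 < t' := by positivity
  have hs'pos : 0 < s' := by positivity
  have hdd : cN * (Z / L * t') * (s' / 8) ≤ |inner ℝ (x₁' - x₂') (y₁ - y₂)| := by
    refine hd.trans_eq ?_
    simp only [dot_eq_inner, inner_sub_left, inner_sub_right]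
    congr 1
    ring
  have zl : Z / L * t' ≤ t' / 4 := by
    have : Z / L ≤ 1 / 4 := by rw [div_le_div_iff₀ hLpos (by norm_num)]; linarith
    nlinarith
  obtain ⟨a₁, ha₁, hpa₁, hda₁⟩ := TX.exists_near j p hp x₁' hx₁'.1 (hx₁'.2.le.trans zl)
  obtain ⟨a₂, ha₂, hpa₂, hda₂⟩ := TX.exists_near j p hp x₂' hx₂'.1 (hx₂'.2.le.trans zl)
  obtain ⟨b₁, hb₁, hqb₁, hdb₁⟩ := TY.exists_near k q hq y₁ hy₁.1
    (hy₁.2.le.trans (by simp only [s'] at hs'pos ⊢; linarith))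
  obtain ⟨b₂, hb₂, hqb₂, hdb₂⟩ := TY.exists_near k q hq y₂ hy₂.1
    (hy₂.2.le.trans (by simp only [s'] at hs'pos ⊢; linarith))
  rw [← htj] at hda₁ hda₂
  rw [← hsk, dist_comm] at hdb₁ hdb₂
  have ma₁ := TX.mem_children.2 ⟨ha₁, hpa₁⟩
  have ma₂ := TX.mem_children.2 ⟨ha₂, hpa₂⟩
  have mb₁ := TY.mem_children.2 ⟨hb₁, hqb₁⟩
  have mb₂ := TY.mem_children.2 ⟨hb₂, hqb₂⟩
  have mixed : ∀ x₁ ∈ Metric.closedBall a₁ (2 * (t * L ^ j)),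
      ∀ x₂ ∈ Metric.closedBall a₂ (2 * (t * L ^ j)),
      9 * (κ * h) ≤ |inner ℝ (x₁ - x₂) (b₁ - b₂)| ∧ |inner ℝ (x₁ - x₂) (b₁ - b₂)| ≤ h ∧
      ‖x₁ - x₂‖ ≤ (2 * Z + 6) * (t' / L) := by
    intro x₁ hx₁ x₂ hx₂
    rw [← htj, Metric.mem_closedBall] at hx₁ hx₂
    refine mixed_difference_bounds hc hc1 hκ hZ hL hh ht'pos hs'pos hts hx₁'.2.le hx₂'.2.le
      hy₁.2.le hy₂.2.le ?_ ?_ hdb₁ hdb₂ hdd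
    · linarith [dist_triangle x₁ a₁ x₁', dist_comm a₁ x₁']
    · linarith [dist_triangle x₂ a₂ x₂', dist_comm a₂ x₂']
  have tj : 0 ≤ 2 * (t * L ^ j) := by positivity
  -- the phases at the centers already show that the two children of `q` are distinct
  have hne : b₁ ≠ b₂ := by
    rintro rfl
    have := (mixed a₁ (Metric.mem_closedBall_self tj) a₂ (Metric.mem_closedBall_self tj)).1
    rw [sub_self, inner_zero_right, abs_zero] at this
    have : 0 < κ * h := by positivity
    linarith
  have ball_sub : ∀ a ∈ TX.children j p, ∀ x ∈ Metric.closedBall a (2 * (t * L ^ j)),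
      x ∈ Metric.closedBall p (2 * t') := by
    intro a ha x hx
    obtain ⟨han, hap⟩ := TX.mem_children.1 ha
    have h1 := TX.dist_parent j a han
    rw [hap] at h1
    rw [Metric.mem_closedBall, ← htj] at hx
    rw [Metric.mem_closedBall]
    have : t' / L ≤ t' / 2 := by gcongr; linarith
    linarith [dist_triangle x a p]
  -- the loss in the two distinguished terms is a loss in the whole sum
  have pair : ∀ x ∈ Metric.closedBall p (2 * t'),
      ‖wave h (b₁ - q) x * G b₁ x + wave h (b₂ - q) x * G b₂ x‖
        ≤ M b₁ + M b₂ - (κ / 8) ^ 2 * min (M b₁) (M b₂) →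
      ‖∑ b ∈ TY.children k q, wave h (b - q) x * G b x‖ ≤
          ∑ b ∈ TY.children k q, M b - (κ / 8) ^ 2 * min (M b₁) (M b₂) := by
    intro x hx hp
    have m : b₂ ∈ (TY.children k q).erase b₁ := Finset.mem_erase.2 ⟨hne.symm, mb₂⟩
    rw [← Finset.add_sum_erase _ _ mb₁, ← Finset.add_sum_erase _ _ m,
      ← Finset.add_sum_erase _ M mb₁, ← Finset.add_sum_erase _ M m, ← add_assoc]
    refine (norm_add_le _ _).trans ?_
    have : ‖∑ b ∈ ((TY.children k q).erase b₁).erase b₂, wave h (b - q) x * G b x‖ ≤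
        ∑ b ∈ ((TY.children k q).erase b₁).erase b₂, M b := by
      refine (norm_sum_le _ _).trans (Finset.sum_le_sum fun b hb => ?_)
      rw [norm_mul, norm_wave, one_mul]
      exact (hG b (Finset.mem_of_mem_erase (Finset.mem_of_mem_erase hb))).norm_le x hx
    linarith
  by_contra hcon
  push Not at hcon
  obtain ⟨x₁, hx₁, hl₁⟩ := hcon a₁ ma₁ b₁ mb₁ b₂ mb₂
  obtain ⟨x₂, hx₂, hl₂⟩ := hcon a₂ ma₂ b₁ mb₁ b₂ mb₂
  have i₁ := ball_sub a₁ ma₁ x₁ hx₁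
  have i₂ := ball_sub a₂ ma₂ x₂ hx₂
  have l₁ := lt_of_not_ge fun hp => hl₁.not_ge (pair x₁ i₁ hp)
  have l₂ := lt_of_not_ge fun hp => hl₂.not_ge (pair x₂ i₂ hp)
  obtain ⟨lower, upper, close⟩ := mixed x₁ hx₁ x₂ hx₂
  have B₁ := hG b₁ mb₁
  have B₂ := hG b₂ mb₂
  -- `L` is large compared with `Z`: the amplitudes vary less between `x₁` and `x₂` than the phase
  have hτ : 2 * κ / t' * ‖x₁ - x₂‖ ≤ κ / 4 := by
    calc 2 * κ / t' * ‖x₁ - x₂‖ ≤ 2 * κ / t' * ((2 * Z + 6) * (t' / L)) := by gcongr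
      _ = 2 * κ * (2 * Z + 6) / L := by field_simp
      _ ≤ κ / 4 := by
        rw [div_le_div_iff₀ hLpos (by norm_num)]
        nlinarith
  have lip : ∀ b ∈ TY.children k q, ‖G b x₁ - G b x₂‖ ≤ κ / 4 * M b := by
    intro b hb
    refine ((hG b hb).lipschitz x₁ i₁ x₂ i₂).trans ?_
    rw [mul_right_comm]
    exact mul_le_mul_of_nonneg_right hτ (hG b hb).nonneg
  have up := norm_wave_mul_sub_le_of_large (σ := κ / 8) (τ := κ / 4) B₁.nonneg B₂.nonneg
    (by positivity) (by linarith) (by positivity) (norm_wave h (b₁ - q) x₁)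
    (norm_wave h (b₁ - q) x₂) (norm_wave h (b₂ - q) x₁) (norm_wave h (b₂ - q) x₂)
    (B₁.norm_le x₁ i₁) (B₁.norm_le x₂ i₂) (B₂.norm_le x₁ i₁) (B₂.norm_le x₂ i₂)
    (lip b₁ mb₁) (lip b₂ mb₂) l₁ l₂
  have low := le_norm_wave_mul_sub hh (b₁ - q) (b₂ - q) x₁ x₂ (by rwa [sub_sub_sub_cancel_right])
  rw [sub_sub_sub_cancel_right] at low
  have : 9 * κ ≤ |inner ℝ (x₁ - x₂) (b₁ - b₂)| / h := by
    rw [le_div_iff₀ hh]; linarith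
  -- the two bounds are `9 κ / 2` from below and `8 (κ / 8) + 4 (κ / 4) = 2 κ` from above
  linarith

/-- One step of the induction on scales, at a pair of nodes `p`, `q`: passing to the children of
`p` and summing over the children of `q` gains a constant factor over Cauchy--Schwarz. -/
theorem exists_contracted_bounds {d : ℕ} {X Y : Set (E d)} {h cN κ Z L t s lam : ℝ} {N N' : ℕ}
    (TX : RegularTree X t L lam N) (TY : RegularTree Y s L lam N') (hlam : 0 < lam)
    (hc : 0 < cN) (hc1 : cN ≤ 1)
    (hκ : κ = cN / 100) (hZ : Z = 128 / cN) (hL : 16 * Z + 48 ≤ L) (hh : 0 < h)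
    (ht : 0 < t) (hs : 0 < s) (hno : IsNonorthogonal dot X Y cN h h 1 1) {j k : ℕ}
    (hjN : j < N) (hkN : k < N')
    (hts : t * L ^ (j + 1) * (s * L ^ (k + 1)) = L * (κ * h))
    (ht' : Z / L * (t * L ^ (j + 1)) ∈ Set.Ioo h 1) (hs' : s * L ^ (k + 1) / 8 ∈ Set.Ioo h 1)
    {p q : E d} (hp : p ∈ TX.node (j + 1)) (hq : q ∈ TY.node (k + 1))
    {G : E d → E d → ℂ} {M : E d → ℝ}
    (hG : ∀ b ∈ TY.children k q, AmplitudeBound (G b)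
      (Metric.closedBall p (2 * (t * L ^ (j + 1)))) (2 * κ / (t * L ^ (j + 1))) (M b)) :
    ∃ M' : E d → ℝ,
      (∀ a ∈ TX.children j p, AmplitudeBound
        (fun x => ∑ b ∈ TY.children k q, wave h (b - q) x * G b x)
        (Metric.closedBall a (2 * (t * L ^ j))) (2 * κ / (t * L ^ j)) (M' a)) ∧
      ∑ a ∈ TX.children j p, TX.weight j a * M' a ^ 2 ≤
        (1 - (κ / 8) ^ 2 * lam ^ 2 / 2) * (TX.weight (j + 1) p *
          (TY.weight (k + 1) q * ∑ b ∈ TY.children k q, M b ^ 2 / TY.weight k b)) := by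
  obtain ⟨a₀, ha₀, b₁, hb₁, b₂, hb₂, hloss⟩ := exists_child_with_loss TX TY hc hc1 hκ hZ hL hh ht hs
    hno hts ht' hs' hp hq hG
  have hZ128 : 128 ≤ Z := by rw [hZ, le_div_iff₀ hc]; linarith
  have hLpos : 0 < L := by linarith
  have hκpos : 0 < κ := by rw [hκ]; positivity
  have hκ1 : κ ≤ 1 / 100 := by rw [hκ]; linarith
  have hη : (κ / 8) ^ 2 ≤ 1 / 4 := by nlinarith
  have htj : t * L ^ (j + 1) / L = t * L ^ j := by rw [pow_succ]; field_simp
  have hMnn : ∀ b ∈ TY.children k q, 0 ≤ M b := fun b hb => (hG b hb).nonneg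
  set S := ∑ b ∈ TY.children k q, M b with hS
  set m := min (M b₁) (M b₂)
  have hS0 : 0 ≤ S := Finset.sum_nonneg hMnn
  have hm0 : 0 ≤ m := le_min (hMnn _ hb₁) (hMnn _ hb₂)
  have hmS : m ≤ S := (min_le_left _ _).trans (Finset.single_le_sum hMnn hb₁)
  have ball_sub : ∀ a ∈ TX.children j p, Metric.closedBall a (2 * (t * L ^ j)) ⊆
      Metric.closedBall p (2 * (t * L ^ (j + 1))) := by
    intro a ha
    obtain ⟨han, hap⟩ := TX.mem_children.1 ha
    have h1 := TX.dist_parent j a han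
    rw [hap] at h1
    refine Metric.closedBall_subset_closedBall' ?_
    rw [← htj]
    have : t * L ^ (j + 1) / L ≤ t * L ^ (j + 1) / 2 := by gcongr; linarith
    linarith
  have close : ∀ b ∈ TY.children k q, ‖b - q‖ ≤ s * L ^ (k + 1) := by
    intro b hb
    obtain ⟨hbn, hbp⟩ := TY.mem_children.1 hb
    have := TY.dist_parent k b hbn
    rwa [hbp, dist_eq_norm] at this
  refine ⟨fun a => if a = a₀ then S - (κ / 8) ^ 2 * m else S, fun a ha => ?_, ?_⟩
  · rw [← htj]
    refine AmplitudeBound.sum_wave hκpos (by linarith) hh (by positivity) hts _ q close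
      (htj ▸ ball_sub a ha) hG ?_ fun x hx => ?_
    · rw [← hS]
      beta_reduce
      split_ifs
      · nlinarith
      · linarith
    · rw [htj] at hx
      beta_reduce
      split_ifs with hif
      · exact hloss x (hif ▸ hx)
      · refine (norm_sum_le _ _).trans (Finset.sum_le_sum fun b hb => ?_)
        rw [norm_mul, norm_wave, one_mul]
        exact (hG b hb).norm_le x (ball_sub a ha hx)
  · obtain ⟨ha₀n, ha₀p⟩ := TX.mem_children.1 ha₀
    have wsum : TX.weight (j + 1) p = ∑ a ∈ TX.children j p, TX.weight j a :=
      TX.weight_sum j hjN p hp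
    have wpos : 0 < TX.weight (j + 1) p := TX.weight_pos _ hjN p hp
    have wnn : ∀ a ∈ TX.children j p, 0 ≤ TX.weight j a := fun a ha =>
      (TX.weight_pos j hjN.le a (TX.mem_children.1 ha).1).le
    have vsum : TY.weight (k + 1) q = ∑ b ∈ TY.children k q, TY.weight k b :=
      TY.weight_sum k hkN q hq
    have vratio : ∀ b ∈ TY.children k q,
        lam * ∑ b ∈ TY.children k q, TY.weight k b ≤ TY.weight k b := by
      intro b hb
      obtain ⟨hbn, hbp⟩ := TY.mem_children.1 hb
      have := TY.weight_ratio k hkN b hbn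
      rwa [hbp, vsum] at this
    have r₀ : lam ≤ TX.weight j a₀ / TX.weight (j + 1) p := by
      rw [le_div_iff₀ wpos]
      have := TX.weight_ratio j hjN a₀ ha₀n
      rwa [ha₀p] at this
    have r₁ : TX.weight j a₀ / TX.weight (j + 1) p ≤ 1 := by
      rw [div_le_one wpos, wsum]
      exact Finset.single_le_sum wnn ha₀
    have gain := weighted_cauchySchwarz_gain (TY.children k q) (TY.weight k) M
      (fun b hb => TY.weight_pos k hkN.le b (TY.mem_children.1 hb).1) hMnn hb₁ hb₂ hlam r₀ r₁
      (by positivity) hη (vratio b₁ hb₁) (vratio b₂ hb₂)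
    rw [← vsum] at gain
    have eval : ∑ a ∈ TX.children j p,
        TX.weight j a * (if a = a₀ then S - (κ / 8) ^ 2 * m else S) ^ 2 =
        TX.weight (j + 1) p * ((1 - TX.weight j a₀ / TX.weight (j + 1) p) * S ^ 2 +
          TX.weight j a₀ / TX.weight (j + 1) p * (S - (κ / 8) ^ 2 * m) ^ 2) := by
      have : ∑ a ∈ (TX.children j p).erase a₀,
          TX.weight j a * (if a = a₀ then S - (κ / 8) ^ 2 * m else S) ^ 2 =
          (∑ a ∈ (TX.children j p).erase a₀, TX.weight j a) * S ^ 2 := by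
        rw [Finset.sum_mul]
        refine Finset.sum_congr rfl fun a ha => ?_
        rw [if_neg (Finset.ne_of_mem_erase ha)]
      rw [← Finset.add_sum_erase _ _ ha₀, this, if_pos rfl]
      rw [← Finset.add_sum_erase _ _ ha₀] at wsum
      have e : ∀ V : ℝ, TX.weight (j + 1) p * ((1 - TX.weight j a₀ / TX.weight (j + 1) p) * S ^ 2 +
          TX.weight j a₀ / TX.weight (j + 1) p * V) =
          (TX.weight (j + 1) p - TX.weight j a₀) * S ^ 2 + TX.weight j a₀ * V := by
        intro V
        field_simp
      rw [e]
      linear_combination (-S ^ 2) * wsum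
    rw [eval, ← mul_left_comm (TX.weight (j + 1) p)]
    exact mul_le_mul_of_nonneg_left gain wpos.le

/-- Induction on scales. A superposition of waves `∑ q, exp (-i x·q / h) F q x` over the finest
nodes of `Y` is regrouped along the tree of `Y`, from level `0` up to level `N`, while the tree of
`X` is descended from level `N` down to level `0`: an amplitude attached to a node of `Y` of scale
`s L ^ k` is nearly constant at the scale `t L ^ (N - k)`, which is about `h / (s L ^ k)`. The
`L²` mass of the bounds decays geometrically in the number of steps. -/
theorem exists_bounds_at_level {d : ℕ} {X Y : Set (E d)} {h cN κ Z L t s lam : ℝ} {N : ℕ}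
    (TX : RegularTree X t L lam N) (TY : RegularTree Y s L lam N) (hlam : 0 < lam)
    (hlam1 : lam ≤ 1) (hc : 0 < cN) (hc1 : cN ≤ 1)
    (hκ : κ = cN / 100) (hZ : Z = 128 / cN) (hL : 16 * Z + 48 ≤ L) (hh : 0 < h)
    (ht : h ≤ t) (hs : h ≤ s) (htN : t * L ^ N ≤ 1) (hsN : s * L ^ N ≤ 1)
    (hno : IsNonorthogonal dot X Y cN h h 1 1)
    (hts : t * L ^ N * s = κ * h) (F : E d → E d → ℂ) (c : E d → ℝ)
    (hF : ∀ q ∈ TY.node 0, AmplitudeBound (F q) Set.univ (2 * s / h) (c q))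
    (k : ℕ) (hk : k ≤ N) :
    ∃ (G : E d → E d → ℂ) (M : E d → E d → ℝ) (A : E d → ℝ),
      (∀ q ∈ TY.node k, 0 ≤ A q) ∧
      (∀ x, ∑ q ∈ TY.node k, wave h q x * G q x = ∑ q ∈ TY.node 0, wave h q x * F q x) ∧
      ∑ q ∈ TY.node k, A q = ∑ q ∈ TY.node 0, c q ^ 2 / TY.weight 0 q ∧
      (∀ q ∈ TY.node k, ∀ p ∈ TX.node (N - k), AmplitudeBound (G q)
        (Metric.closedBall p (2 * (t * L ^ (N - k)))) (2 * κ / (t * L ^ (N - k))) (M p q)) ∧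
      ∀ q ∈ TY.node k, ∑ p ∈ TX.node (N - k), TX.weight (N - k) p * M p q ^ 2 ≤
        (1 - (κ / 8) ^ 2 * lam ^ 2 / 2) ^ k * (∑ p ∈ TX.node N, TX.weight N p) *
          (TY.weight k q * A q) := by
  have hZ128 : 128 ≤ Z := by rw [hZ, le_div_iff₀ hc]; linarith
  have hLpos : 0 < L := by linarith
  have hL1 : 1 ≤ L := by linarith
  have hκpos : 0 < κ := by rw [hκ]; positivity
  have hκ1 : κ ≤ 1 / 100 := by rw [hκ]; linarith
  have tpos : 0 < t := hh.trans_le ht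
  have spos : 0 < s := hh.trans_le hs
  induction k with
  | zero =>
    refine ⟨F, fun _ q => c q, fun q => c q ^ 2 / TY.weight 0 q, fun q hq => ?_,
      fun _ => rfl, rfl, ?_, ?_⟩
    · exact div_nonneg (sq_nonneg _) (TY.weight_pos 0 (Nat.zero_le _) q hq).le
    · intro q hq p _
      have : 2 * κ / (t * L ^ (N - 0)) = 2 * s / h := by
        rw [Nat.sub_zero, div_eq_div_iff (by positivity) hh.ne']
        linear_combination (-2) * hts
      rw [this]
      exact ⟨(hF q hq).nonneg, fun x _ => (hF q hq).norm_le x trivial,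
        fun x _ y _ => (hF q hq).lipschitz x trivial y trivial⟩
    · intro q hq
      have := TY.weight_pos 0 (Nat.zero_le _) q hq
      rw [Nat.sub_zero, ← Finset.sum_mul, pow_zero, one_mul, mul_div_cancel₀ _ this.ne']
  | succ k ih =>
    obtain ⟨G, M, A, hA0, hsum, hA, hM, hmass⟩ := ih (by omega)
    obtain ⟨j, hj⟩ : ∃ j, N = j + 1 + k := ⟨N - k - 1, by omega⟩
    have e1 : N - k = j + 1 := by omega
    have e2 : N - (k + 1) = j := by omega
    rw [e1] at hM hmass
    rw [e2]
    have powle : ∀ i, i ≤ N → L ^ i ≤ L ^ N := fun i hi => pow_le_pow_right₀ hL1 hi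
    have hts' : t * L ^ (j + 1) * (s * L ^ (k + 1)) = L * (κ * h) := by
      rw [← hts, hj, pow_add L (j + 1) k, pow_succ L k]; ring
    have ht' : Z / L * (t * L ^ (j + 1)) ∈ Set.Ioo h 1 := by
      constructor
      · have : Z / L * (t * L ^ (j + 1)) = Z * (t * L ^ j) := by rw [pow_succ]; field_simp
        rw [this]
        have : t ≤ t * L ^ j := le_mul_of_one_le_right tpos.le (one_le_pow₀ hL1)
        nlinarith
      · have h1 : t * L ^ (j + 1) ≤ 1 := 
          (mul_le_mul_of_nonneg_left (powle _ (by omega)) tpos.le).trans htN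
        have h2 : Z / L < 1 := by rw [div_lt_one hLpos]; linarith
        have h3 : 0 < t * L ^ (j + 1) := by positivity
        nlinarith
    have hs' : s * L ^ (k + 1) / 8 ∈ Set.Ioo h 1 := by
      constructor
      · have h1 : L * 1 ≤ L * L ^ k := by gcongr; exact one_le_pow₀ hL1
        rw [pow_succ']
        nlinarith
      · have h1 : s * L ^ (k + 1) ≤ 1 := 
          (mul_le_mul_of_nonneg_left (powle _ (by omega)) spos.le).trans hsN
        linarith
    have step : ∀ q ∈ TY.node (k + 1), ∀ p ∈ TX.node (j + 1), _ := fun q hq p hp =>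
      exists_contracted_bounds TX TY hlam hc hc1 hκ hZ hL hh tpos spos hno (by omega) (by omega)
        hts' ht' hs' hp hq (M := M p)
        fun b hb => hM b (TY.mem_children.1 hb).1 p hp
    choose! M' hM' hgain using step
    refine ⟨fun q x => ∑ b ∈ TY.children k q, wave h (b - q) x * G b x,
      fun a q => M' q (TX.parent j a) a, fun q => ∑ b ∈ TY.children k q, A b,
      fun q _ => Finset.sum_nonneg fun b hb => hA0 b (TY.mem_children.1 hb).1, ?_, ?_, ?_, ?_⟩
    · intro x
      rw [← hsum x, ← TY.sum_children k]
      refine Finset.sum_congr rfl fun q _ => ?_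
      rw [Finset.mul_sum]
      refine Finset.sum_congr rfl fun b _ => ?_
      rw [← mul_assoc, ← wave_add, add_sub_cancel]
    · rw [TY.sum_children, hA]
    · intro q hq a ha
      exact hM' q hq _ (TX.parent_mem j a ha) a (TX.mem_children.2 ⟨ha, rfl⟩)
    · intro q hq
      set ρ := 1 - (κ / 8) ^ 2 * lam ^ 2 / 2
      have hρ : 0 ≤ ρ := by
        have h1 : (κ / 8) ^ 2 ≤ 1 := by nlinarith
        have h2 : lam ^ 2 ≤ 1 := by nlinarith
        have h3 : (κ / 8) ^ 2 * lam ^ 2 ≤ 1 := mul_le_one₀ h1 (by positivity) h2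
        simp only [ρ]
        linarith
      set W := ∑ p ∈ TX.node N, TX.weight N p
      have wq : 0 ≤ TY.weight (k + 1) q := (TY.weight_pos _ hk q hq).le
      calc ∑ a ∈ TX.node j, TX.weight j a * M' q (TX.parent j a) a ^ 2
          = ∑ p ∈ TX.node (j + 1), ∑ a ∈ TX.children j p, TX.weight j a * M' q p a ^ 2 := by
            rw [← TX.sum_children j]
            refine Finset.sum_congr rfl fun p _ => Finset.sum_congr rfl fun a ha => ?_
            rw [(TX.mem_children.1 ha).2]
        _ ≤ ∑ p ∈ TX.node (j + 1), ρ * (TX.weight (j + 1) p *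
              (TY.weight (k + 1) q * ∑ b ∈ TY.children k q, M p b ^ 2 / TY.weight k b)) :=
            Finset.sum_le_sum fun p hp => hgain q hq p hp
        _ = ρ * (TY.weight (k + 1) q * ∑ b ∈ TY.children k q,
              (∑ p ∈ TX.node (j + 1), TX.weight (j + 1) p * M p b ^ 2) / TY.weight k b) := by
            simp only [Finset.mul_sum, Finset.sum_div]
            rw [Finset.sum_comm]
            refine Finset.sum_congr rfl fun b _ => Finset.sum_congr rfl fun p _ => ?_
            ring
        _ ≤ ρ * (TY.weight (k + 1) q * ∑ b ∈ TY.children k q, ρ ^ k * W * A b) := by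
            gcongr with b hb
            have hbn := (TY.mem_children.1 hb).1
            have wb := TY.weight_pos k (by omega) b hbn
            rw [div_le_iff₀ wb]
            refine (hmass b hbn).trans_eq ?_
            ring
        _ = ρ ^ (k + 1) * W * (TY.weight (k + 1) q * ∑ b ∈ TY.children k q, A b) := by
            rw [← Finset.mul_sum]; ring

/-! ### Regular sets carry regular trees -/

/-- A compact set contains a finite `t`-separated set from which none of its points is further
than `t`. -/
theorem exists_finset_net {d : ℕ} {X : Set (E d)} (hX : IsCompact X) {t : ℝ} (ht : 0 < t) :
    ∃ P : Finset (E d), (∀ a ∈ P, a ∈ X) ∧ (∀ x ∈ X, ∃ a ∈ P, dist x a ≤ t) ∧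
      ∀ a ∈ P, ∀ b ∈ P, dist a b ≤ t → a = b := by
  lift t to NNReal using ht.le
  have ht0 : t / 2 ≠ 0 := by
    have : 0 < t := by exact_mod_cast ht
    exact (half_pos this).ne'
  have hpack : Metric.packingNumber t X ≠ ⊤ := by
    obtain ⟨N, hN, hNf, hNc⟩ := Metric.exists_finite_isCover_of_isCompact ht0 hX
    have h1 := Metric.packingNumber_two_mul_le_externalCoveringNumber (t / 2) X
    rw [mul_div_cancel₀ _ (two_ne_zero)] at h1
    have h2 : Metric.externalCoveringNumber (t / 2) X ≤ N.encard :=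
      iInf₂_le N hNc
    exact ne_top_of_le_ne_top hNf.encard_lt_top.ne (h1.trans h2)
  have hfin : (Metric.maximalSeparatedSet t X).Finite := by
    rw [← Set.encard_ne_top_iff, Metric.encard_maximalSeparatedSet hpack]
    exact hpack
  refine ⟨hfin.toFinset, fun a ha => Metric.maximalSeparatedSet_subset (hfin.mem_toFinset.1 ha),
    fun x hx => ?_, fun a ha b hb hab => ?_⟩
  · obtain ⟨a, ha, hxa⟩ := Metric.isCover_maximalSeparatedSet hpack hx
    refine ⟨a, hfin.mem_toFinset.2 ha, ?_⟩
    have : edist x a ≤ t := hxa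
    rwa [edist_nndist, ENNReal.coe_le_coe, ← NNReal.coe_le_coe, coe_nndist] at this
  · by_contra hne
    have h1 := Metric.isSeparated_maximalSeparatedSet (hfin.mem_toFinset.1 ha)
      (hfin.mem_toFinset.1 hb) hne
    have h2 : (t : ℝ≥0∞) < edist a b := h1
    rw [edist_nndist, ENNReal.coe_lt_coe, ← NNReal.coe_lt_coe, coe_nndist] at h2
    exact h2.not_ge hab

theorem exists_simpleFunc_nearest {d : ℕ} (P : Finset (E d)) (hP : P.Nonempty) :
    ∃ c : SimpleFunc (E d) (E d), (∀ x, c x ∈ P) ∧ ∀ x, ∀ p ∈ P, dist x (c x) ≤ dist x p := by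
  obtain ⟨e, he⟩ := P.countable_toSet.exists_eq_range (by simpa using hP)
  have hmem : ∀ p ∈ P, ∃ n, e n = p := fun p hp => by
    have : p ∈ Set.range e := he ▸ hp
    exact this
  choose! n hn using hmem
  refine ⟨SimpleFunc.nearestPt e (P.sup n), fun x => ?_, fun x p hp => ?_⟩
  · have : SimpleFunc.nearestPt e (P.sup n) x ∈ (P : Set (E d)) := by
      rw [he]
      exact ⟨_, rfl⟩
    exact this
  · have := SimpleFunc.edist_nearestPt_le e x (Finset.le_sup (f := n) hp)
    rw [hn p hp, edist_dist, edist_dist, ENNReal.ofReal_le_ofReal_iff dist_nonneg] at this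
    rwa [dist_comm, dist_comm x]

/-- The ancestor of level `k` of a point: the nearest node of level `0`, followed by nearest nodes
of the levels `1, …, k`. -/
noncomputable def ancestor {d : ℕ} (c : ℕ → SimpleFunc (E d) (E d)) : ℕ → SimpleFunc (E d) (E d)
  | 0 => c 0
  | k + 1 => (ancestor c k).map (c (k + 1))

theorem measureReal_le_of_inter_support_subset {d : ℕ} {μ : Measure (E d)} [IsFiniteMeasure μ]
    {s t : Set (E d)} (h : s ∩ μ.support ⊆ t) : μ.real s ≤ μ.real t := by
  have : μ s = μ (s ∩ μ.support) :=
    (measure_inter_conull Measure.measure_compl_support).symm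
  rw [measureReal_def, this, ← measureReal_def]
  exact measureReal_mono h

/-- The support of an Ahlfors--David regular measure carries a regular tree, with the mass of the
set of points having a given ancestor as the weight. -/
theorem IsADRegularMeasure.exists_regularTree {d : ℕ} {μ : Measure (E d)} {δ h C : ℝ}
    (hμ : IsADRegularMeasure μ δ h 1 C) (hne : μ.support.Nonempty) {t L lam : ℝ} {N : ℕ}
    (hh : 0 < h) (ht : 4 * h ≤ t) (hL : 16 ≤ L) (htN : t * L ^ N ≤ 1 / 2)
    (hlam : lam ≤ (C ^ 2 * (8 * L) ^ δ)⁻¹) :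
    ∃ T : RegularTree μ.support t L lam N,
      (∀ x ∈ μ.support, ∃ a ∈ T.node 0, dist x a ≤ t) ∧
      (∀ k ≤ N, ∀ a ∈ T.node k, C⁻¹ * (t * L ^ k / 4) ^ δ ≤ T.weight k a) ∧
      ∀ k, ∑ a ∈ T.node k, T.weight k a ≤ μ.real Set.univ := by
  have := hμ.isFiniteMeasure
  have hLpos : 0 < L := by linarith
  have hL1 : 1 ≤ L := by linarith
  have tpos : 0 < t := by linarith
  have C1 := hμ.one_le_const
  have C0 : 0 < C := by linarith
  have scale_pos : ∀ k, 0 < t * L ^ k := fun k => by positivity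
  have net := fun k => exists_finset_net hμ.isCompact_support (scale_pos k)
  choose P hPsub hPcov hPsep using net
  have hPne : ∀ k, (P k).Nonempty := fun k => by
    obtain ⟨x, hx⟩ := hne
    obtain ⟨a, ha, -⟩ := hPcov k x hx
    exact ⟨a, ha⟩
  have near := fun k => exists_simpleFunc_nearest (P k) (hPne k)
  choose c hcmem hcle using near
  have scale_succ : ∀ k, t * L ^ k ≤ t * L ^ (k + 1) / 16 := fun k => by
    rw [pow_succ]
    have := scale_pos k
    nlinarith
  have cdist : ∀ k, ∀ x ∈ μ.support, dist x (c k x) ≤ t * L ^ k := fun k x hx => by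
    obtain ⟨a, ha, hxa⟩ := hPcov k x hx
    exact (hcle k x a ha).trans hxa
  -- nodes of level `k` are `t L ^ k`-separated, so at most one lies within half that distance
  have cuniq : ∀ k x, ∀ p ∈ P k, dist x p ≤ t * L ^ k / 2 → c k x = p := by
    intro k x p hp hxp
    refine hPsep k _ (hcmem k x) p hp ?_
    have := hcle k x p hp
    linarith [dist_triangle (c k x) x p, dist_comm x (c k x)]
  have amem : ∀ k x, ancestor c k x ∈ P k := fun k x => by
    cases k with
    | zero => exact hcmem 0 x
    | succ k => exact hcmem (k + 1) _
  have adist : ∀ k, ∀ x ∈ μ.support, dist x (ancestor c k x) ≤ 2 * (t * L ^ k) := by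
    intro k x hx
    induction k with
    | zero => exact (cdist 0 x hx).trans (by linarith [scale_pos 0])
    | succ k ih =>
      have h1 := cdist (k + 1) (ancestor c k x) (hPsub k _ (amem k x))
      have h2 : ancestor c (k + 1) x = c (k + 1) (ancestor c k x) := rfl
      rw [h2]
      linarith [dist_triangle x (ancestor c k x) (c (k + 1) (ancestor c k x)), scale_succ k,
        scale_pos (k + 1)]
  have auniq : ∀ k, ∀ x ∈ μ.support, ∀ p ∈ P k, dist x p ≤ t * L ^ k / 4 → ancestor c k x = p := by
    intro k x hx p hp hxp
    cases k with
    | zero => exact cuniq 0 x p hp (by linarith [scale_pos 0])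
    | succ k =>
      refine cuniq (k + 1) (ancestor c k x) p hp ?_
      linarith [dist_triangle (ancestor c k x) x p, dist_comm x (ancestor c k x), adist k x hx,
        scale_succ k, scale_pos (k + 1)]
  set w : ℕ → E d → ℝ := fun k p => μ.real (ancestor c k ⁻¹' {p}) with hw
  have scale_le : ∀ k ≤ N, t * L ^ k ≤ 1 / 2 := fun k hk =>
    (mul_le_mul_of_nonneg_left (pow_le_pow_right₀ hL1 hk) tpos.le).trans htN
  have scale_ge : ∀ k, 4 * h ≤ t * L ^ k := fun k =>
    ht.trans (le_mul_of_one_le_right tpos.le (one_le_pow₀ hL1))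
  -- the points with ancestor `a` fill a ball around `a` of a quarter of the scale, whose radius is
  -- at least `h`, and lie in the ball of twice the scale, whose radius is at most `1`
  have wlow : ∀ k ≤ N, ∀ a ∈ P k, C⁻¹ * (t * L ^ k / 4) ^ δ ≤ w k a := by
    intro k hk a ha
    refine (hμ.le_ball a (hPsub k a ha) (t * L ^ k / 4) (by linarith [scale_ge k])
      (by linarith [scale_le k hk])).trans ?_
    refine measureReal_le_of_inter_support_subset fun x hx => ?_
    exact auniq k x hx.2 a ha hx.1
  have wup : ∀ k ≤ N, ∀ a ∈ P k, w k a ≤ C * (2 * (t * L ^ k)) ^ δ := by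
    intro k hk a ha
    refine le_trans ?_ (hμ.ball_le a (2 * (t * L ^ k)) (by linarith [scale_ge k])
      (by linarith [scale_le k hk]))
    refine measureReal_le_of_inter_support_subset fun x hx => ?_
    have h1 : ancestor c k x = a := hx.1
    rw [Metric.mem_closedBall, ← h1]
    exact adist k x hx.2
  refine ⟨{ node := P
            parent := fun k a => c (k + 1) a
            weight := w
            node_subset := hPsub
            parent_mem := fun k a _ => hcmem (k + 1) a
            dist_parent := fun k a ha => cdist (k + 1) a (hPsub k a ha)
            exists_near := fun k p hp x hx hxp => ?_
            weight_pos := fun k hk a ha => lt_of_lt_of_le ?_ (wlow k hk a ha)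
            weight_sum := fun k _ p hp => ?_
            weight_ratio := fun k hk a ha => ?_ }, ?_, wlow, fun k => ?_⟩
  · obtain ⟨a, ha, hxa⟩ := hPcov k x hx
    refine ⟨a, ha, cuniq (k + 1) a p hp ?_, hxa⟩
    linarith [dist_triangle a x p, dist_comm x a, scale_succ k, scale_pos (k + 1)]
  · have := scale_pos k
    positivity
  · simp only [hw]
    rw [sum_measureReal_preimage_singleton _ fun y _ => SimpleFunc.measurableSet_fiber _ y]
    congr 1
    ext x
    have h2 : ancestor c (k + 1) x = c (k + 1) (ancestor c k x) := rfl
    simp [h2, amem k x]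
  · refine le_trans ?_ (wlow k hk.le a ha)
    have h1 := wup (k + 1) hk (c (k + 1) a) (hcmem (k + 1) a)
    have := scale_pos k
    have := scale_pos (k + 1)
    have h0 : 0 ≤ w (k + 1) (c (k + 1) a) := measureReal_nonneg
    calc lam * w (k + 1) (c (k + 1) a)
        ≤ (C ^ 2 * (8 * L) ^ δ)⁻¹ * (C * (2 * (t * L ^ (k + 1))) ^ δ) :=
          mul_le_mul hlam h1 h0 (by positivity)
      _ = C⁻¹ * (t * L ^ k / 4) ^ δ := by
          have e : 2 * (t * L ^ (k + 1)) = (8 * L) * (t * L ^ k / 4) := by rw [pow_succ]; ring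
          rw [e, Real.mul_rpow (x := 8 * L) (y := t * L ^ k / 4) (by positivity) (by positivity)]
          have : (8 * L) ^ δ ≠ 0 := (Real.rpow_pos_of_pos (by positivity) _).ne'
          generalize (8 * L) ^ δ = u at *
          generalize (t * L ^ k / 4) ^ δ = v at *
          field_simp
  · intro x hx
    simpa using hPcov 0 x hx
  · simp only [hw]
    rw [sum_measureReal_preimage_singleton _ fun y _ => SimpleFunc.measurableSet_fiber _ y]
    exact measureReal_mono (Set.subset_univ _)

/-- The mass of a regular measure whose support has diameter at most `R` is bounded in terms of
the regularity constant. -/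
theorem exists_mass_bound (d : ℕ) (R : ℝ) : ∃ n : ℝ, 0 < n ∧ ∀ (μ : Measure (E d)) (δ h C : ℝ),
    IsADRegularMeasure μ δ h 1 C → h ≤ 1 → Metric.diam μ.support ≤ R →
      μ.real Set.univ ≤ n * C := by
  obtain ⟨T, -, hTf, hT⟩ := (isCompact_closedBall (0 : E d) R).finite_cover_balls zero_lt_one
  refine ⟨hTf.toFinset.card + 1, by positivity, fun μ δ h C hμ hh hR => ?_⟩
  have := hμ.isFiniteMeasure
  have C0 : 0 ≤ C := zero_le_one.trans hμ.one_le_const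
  rcases μ.support.eq_empty_or_nonempty with he | ⟨x₀, hx₀⟩
  · rw [Measure.support_eq_empty_iff] at he
    simp only [he, measureReal_zero, Pi.zero_apply]
    positivity
  have cover : μ.real Set.univ ≤ μ.real (⋃ a ∈ hTf.toFinset, Metric.closedBall (x₀ + a) 1) := by
    refine measureReal_le_of_inter_support_subset fun x hx => ?_
    have h1 : x - x₀ ∈ Metric.closedBall (0 : E d) R := by
      rw [mem_closedBall_zero_iff, ← dist_eq_norm]
      exact (Metric.dist_le_diam_of_mem hμ.isCompact_support.isBounded hx.2 hx₀).trans hR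
    obtain ⟨a, ha, hxa⟩ := Set.mem_iUnion₂.1 (hT h1)
    refine Set.mem_iUnion₂.2 ⟨a, hTf.mem_toFinset.2 ha, ?_⟩
    rw [Metric.mem_ball, dist_eq_norm] at hxa
    rw [Metric.mem_closedBall, dist_eq_norm, ← sub_sub]
    exact hxa.le
  refine cover.trans ((measureReal_biUnion_finset_le _ _).trans ?_)
  refine (Finset.sum_le_card_nsmul _ _ C fun a _ => ?_).trans ?_
  · simpa using hμ.ball_le (x₀ + a) 1 hh le_rfl
  · rw [nsmul_eq_mul]
    nlinarith

/-! ### Reduction of the operator norm to sums of waves -/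

theorem isOpen_nbhd {d : ℕ} (Y : Set (E d)) (h : ℝ) : IsOpen (nbhd Y h) :=
  Metric.isOpen_ball.add_left

theorem semiclassicalFourier_eq {d : ℕ} (h : ℝ) (f : E d → ℂ) (ξ : E d) :
    semiclassicalFourier h f ξ =
      (((2 * Real.pi * h) ^ (-(d : ℝ) / 2) : ℝ) : ℂ) * ∫ y : E d, wave h y ξ * f y := by
  rw [semiclassicalFourier]
  congr 2
  ext y
  rw [wave, dot_eq_inner, real_inner_comm]
  congr 2
  push_cast
  ring

theorem continuous_wave {d : ℕ} (h : ℝ) (q ξ : E d) : Continuous fun y => wave h (y - q) ξ := by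
  unfold wave
  fun_prop

theorem enorm_sq_eq {z : ℂ} : ‖z‖ₑ ^ 2 = ENNReal.ofReal (‖z‖ ^ 2) := by
  rw [ENNReal.ofReal_pow (norm_nonneg _), ofReal_norm]

theorem eLpNorm_two_sq {d : ℕ} (f : E d → ℂ) (μ : Measure (E d)) :
    eLpNorm f 2 μ ^ 2 = ∫⁻ x, ‖f x‖ₑ ^ 2 ∂μ := by
  have := eLpNorm_nnreal_pow_eq_lintegral (f := f) (μ := μ) (p := 2) two_ne_zero
  simpa using this

/-- Cauchy--Schwarz on a set of finite measure. -/
theorem sq_integral_norm_le {d : ℕ} {g : E d → ℂ} (hg : Integrable g) (A : Set (E d)) :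
    ENNReal.ofReal ((∫ y in A, ‖g y‖) ^ 2) ≤ volume A * ∫⁻ y in A, ‖g y‖ₑ ^ 2 := by
  have h1 := eLpNorm_le_eLpNorm_mul_rpow_measure_univ (p := 1) (q := 2)
    (μ := volume.restrict A) (f := g) (by norm_num) hg.aestronglyMeasurable.restrict
  rw [eLpNorm_one_eq_lintegral_enorm, ← ofReal_integral_norm_eq_lintegral_enorm hg.restrict] at h1
  have h2 := pow_le_pow_left₀ zero_le h1 2
  rw [mul_pow, eLpNorm_two_sq, ← ENNReal.ofReal_pow (by positivity)] at h2
  refine h2.trans_eq ?_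
  rw [mul_comm, Measure.restrict_apply_univ, ← ENNReal.rpow_natCast, ← ENNReal.rpow_mul]
  norm_num

/-- The contribution to `∫ exp (-i x·y / h) g y` of the points `y` within `ρ` of `q`, modulated to
frequency zero, has Lipschitz constant `ρ / h` relative to the `L¹` norm of `g`. -/
theorem amplitudeBound_integral {d : ℕ} {h ρ : ℝ} (hh : 0 < h) {g : E d → ℂ}
    (hg : Integrable g) (q : E d) {V : Set (E d)} (hV : MeasurableSet V)
    (hVρ : ∀ y ∈ V, g y ≠ 0 → dist y q ≤ ρ) :
    AmplitudeBound (fun x => ∫ y in V, wave h (y - q) x * g y) Set.univ (ρ / h)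
      (∫ y in V, ‖g y‖) where
  nonneg := by positivity
  norm_le x _ := by
    refine norm_integral_le_of_norm_le hg.norm.restrict (Filter.Eventually.of_forall fun y => ?_)
    rw [norm_mul, norm_wave, one_mul]
  lipschitz x _ x' _ := by
    have int : ∀ x, Integrable (fun y => wave h (y - q) x * g y) (volume.restrict V) := fun x =>
      hg.restrict.bdd_mul (continuous_wave h q x).aestronglyMeasurable
        (Filter.Eventually.of_forall fun y => (norm_wave h (y - q) x).le)
    rw [← integral_sub (int x) (int x'), mul_right_comm, ← integral_const_mul]
    refine norm_integral_le_of_norm_le (hg.norm.restrict.const_mul _)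
      ((ae_restrict_iff' hV).2 (Filter.Eventually.of_forall fun y hy => ?_))
    rw [← sub_mul, norm_mul]
    by_cases h0 : g y = 0
    · simp [h0]
    refine mul_le_mul_of_nonneg_right ((norm_wave_sub_le hh _ _ _).trans ?_) (norm_nonneg _)
    have := hVρ y hy h0
    rw [dist_eq_norm] at this
    gcongr

/-- From discrete to continuous: if `X_h` and `Y_h` are covered by balls around the points of `P`
and `Q`, then the norm of `1_{X_h} 𝓕_h 1_{Y_h}` is controlled by the best constant `K` in an `ℓ²`
bound for superpositions of waves with frequencies in `Q` and slowly varying amplitudes. -/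
theorem l2OpNorm_localizedFourier_le {d : ℕ} {X Y : Set (E d)} {h : ℝ} (hh : 0 < h)
    {P Q : Finset (E d)} (hQ : Q.Nonempty) {ρX ρY : ℝ} (hρX : 0 ≤ ρX) (hρY : 0 ≤ ρY)
    (hX : ∀ x ∈ nbhd X h, ∃ p ∈ P, dist x p ≤ ρX) (hY : ∀ y ∈ nbhd Y h, ∃ q ∈ Q, dist y q ≤ ρY)
    {K : ℝ} (hK0 : 0 ≤ K)
    (hK : ∀ (F : E d → E d → ℂ) (c : E d → ℝ),
      (∀ q ∈ Q, AmplitudeBound (F q) Set.univ (ρY / h) (c q)) →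
      ∃ M : E d → ℝ,
        (∀ p ∈ P, ∀ x ∈ Metric.closedBall p ρX, ‖∑ q ∈ Q, wave h q x * F q x‖ ≤ M p) ∧
        ∑ p ∈ P, M p ^ 2 ≤ K * ∑ q ∈ Q, c q ^ 2) :
    l2OpNorm (localizedFourier X Y h) ≤ ENNReal.ofReal ((2 * Real.pi * h) ^ (-(d : ℝ) / 2) *
      √((ρX ^ d * volume.real (Metric.ball (0 : E d) 1)) *
        (ρY ^ d * volume.real (Metric.ball (0 : E d) 1)) * K)) := by
  refine sInf_le fun f hf => ?_
  set a := (2 * Real.pi * h) ^ (-(d : ℝ) / 2) with ha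
  have ha0 : 0 ≤ a := by positivity
  have vol : ∀ (q : E d) {r : ℝ}, 0 ≤ r → volume (Metric.closedBall q r) =
      ENNReal.ofReal (r ^ d * volume.real (Metric.ball (0 : E d) 1)) := by
    intro q r hr
    rw [Measure.addHaar_closedBall volume q hr, finrank_euclideanSpace_fin,
      ENNReal.ofReal_mul (by positivity), ofReal_measureReal]
  have vX0 : 0 ≤ ρX ^ d * volume.real (Metric.ball (0 : E d) 1) := by positivity
  have vY0 : 0 ≤ ρY ^ d * volume.real (Metric.ball (0 : E d) 1) := by positivity
  set vX := ρX ^ d * volume.real (Metric.ball (0 : E d) 1)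
  set vY := ρY ^ d * volume.real (Metric.ball (0 : E d) 1)
  have mY : MeasurableSet (nbhd Y h) := (isOpen_nbhd Y h).measurableSet
  have finY : volume (nbhd Y h) < ⊤ := by
    refine (measure_mono (t := ⋃ q ∈ Q, Metric.closedBall q ρY) fun y hy => ?_).trans_lt
      ((measure_biUnion_finset_le _ _).trans_lt
        (ENNReal.sum_lt_top.2 fun q _ => measure_closedBall_lt_top))
    obtain ⟨q, hq, hyq⟩ := hY y hy
    exact Set.mem_iUnion₂.2 ⟨q, hq, hyq⟩
  set g := (nbhd Y h).indicator f with hg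
  have gint : Integrable g := by
    rw [hg, integrable_indicator_iff mY]
    have : IsFiniteMeasure (volume.restrict (nbhd Y h)) :=
      ⟨by rwa [Measure.restrict_apply_univ]⟩
    exact (hf.restrict (nbhd Y h)).integrable (by norm_num)
  have gsupp : ∀ y, g y ≠ 0 → y ∈ nbhd Y h := fun y hy => by
    by_contra hc
    exact hy (Set.indicator_of_notMem hc f)
  obtain ⟨c, hcQ, hcle⟩ := exists_simpleFunc_nearest Q hQ
  have cdist : ∀ y ∈ nbhd Y h, dist y (c y) ≤ ρY := fun y hy => by
    obtain ⟨q, hq, hyq⟩ := hY y hy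
    exact (hcle y q hq).trans hyq
  have mV : ∀ q, MeasurableSet (c ⁻¹' {q}) := fun q => SimpleFunc.measurableSet_fiber c q
  have disjV : Pairwise (Function.onFun Disjoint fun q => c ⁻¹' {q}) := fun q q' hqq =>
    Disjoint.preimage _ (by simpa using hqq)
  have unionV : ⋃ q ∈ Q, c ⁻¹' {q} = Set.univ := by
    refine Set.eq_univ_of_forall fun y => ?_
    simpa using hcQ y
  obtain ⟨M, hM, hMsum⟩ := hK (fun q x => ∫ y in c ⁻¹' {q}, wave h (y - q) x * g y)
    (fun q => ∫ y in c ⁻¹' {q}, ‖g y‖) fun q _ =>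
      amplitudeBound_integral hh gint q (mV q) fun y hy h0 => by
        have h1 : c y = q := hy
        exact h1 ▸ cdist y (gsupp y h0)
  have four : ∀ x, semiclassicalFourier h g x =
      a * ∑ q ∈ Q, wave h q x * ∫ y in c ⁻¹' {q}, wave h (y - q) x * g y := by
    intro x
    have int : Integrable (fun y => wave h y x * g y) := by
      have := continuous_wave h 0 x
      simp only [sub_zero] at this
      exact gint.bdd_mul this.aestronglyMeasurable
        (Filter.Eventually.of_forall fun y => (norm_wave h y x).le)
    rw [semiclassicalFourier_eq, ← setIntegral_univ, ← unionV,
      integral_biUnion_finset Q (fun q _ => mV q) (fun _ _ _ _ hqq => disjV hqq)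
        fun q _ => int.integrableOn]
    congr 1
    refine Finset.sum_congr rfl fun q _ => ?_
    rw [← integral_const_mul]
    congr 1
    ext y
    rw [← mul_assoc, ← wave_add, add_sub_cancel]
  -- the `ℓ²` norm of the amplitude bounds
  have input : ENNReal.ofReal (∑ q ∈ Q, (∫ y in c ⁻¹' {q}, ‖g y‖) ^ 2) ≤
      ENNReal.ofReal vY * eLpNorm f 2 volume ^ 2 := by
    have part : ∀ q, ENNReal.ofReal ((∫ y in c ⁻¹' {q}, ‖g y‖) ^ 2) ≤
        ENNReal.ofReal vY * ∫⁻ y in c ⁻¹' {q}, ‖g y‖ₑ ^ 2 := by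
      intro q
      have e : ∫ y in c ⁻¹' {q}, ‖g y‖ = ∫ y in c ⁻¹' {q} ∩ Metric.closedBall q ρY, ‖g y‖ := by
        refine (setIntegral_eq_of_subset_of_forall_sdiff_eq_zero (mV q) Set.inter_subset_left
          fun y hy => ?_)
        rw [norm_eq_zero]
        by_contra h0
        have h1 : c y = q := hy.1
        exact hy.2 ⟨hy.1, h1 ▸ cdist y (gsupp y h0)⟩
      rw [e]
      refine (sq_integral_norm_le gint _).trans (mul_le_mul' ?_ ?_)
      · rw [← vol q hρY]
        exact measure_mono Set.inter_subset_right
      · exact lintegral_mono_set Set.inter_subset_left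
    rw [ENNReal.ofReal_sum_of_nonneg fun q _ => sq_nonneg _]
    refine (Finset.sum_le_sum fun q _ => part q).trans ?_
    rw [← Finset.mul_sum, ← lintegral_biUnion_finset (fun _ _ _ _ hqq => disjV hqq)
      (fun q _ => mV q), unionV, setLIntegral_univ, eLpNorm_two_sq]
    gcongr with y
    exact enorm_indicator_le_enorm_self f y
  have output : eLpNorm (localizedFourier X Y h f) 2 volume ^ 2 ≤
      ENNReal.ofReal vX * ENNReal.ofReal (a ^ 2 * ∑ p ∈ P, M p ^ 2) := by
    have pointwise : ∀ x, ‖localizedFourier X Y h f x‖ₑ ^ 2 ≤ ∑ p ∈ P,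
        (Metric.closedBall p ρX).indicator (fun _ => ENNReal.ofReal (a ^ 2 * M p ^ 2)) x := by
      intro x
      by_cases hx : x ∈ nbhd X h
      · obtain ⟨p, hp, hxp⟩ := hX x hx
        refine le_trans ?_ (Finset.single_le_sum (fun _ _ => zero_le) hp)
        rw [Set.indicator_of_mem (Metric.mem_closedBall.2 hxp), localizedFourier,
          Set.indicator_of_mem hx, four, enorm_sq_eq, norm_mul, Complex.norm_real,
          Real.norm_of_nonneg ha0, mul_pow]
        gcongr
        exact hM p hp x hxp
      · simp [localizedFourier, Set.indicator_of_notMem hx]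
    rw [eLpNorm_two_sq]
    refine (lintegral_mono pointwise).trans ?_
    rw [lintegral_finsetSum _ fun p _ =>
      measurable_const.indicator Metric.isClosed_closedBall.measurableSet, Finset.mul_sum,
      ENNReal.ofReal_sum_of_nonneg fun p _ => by positivity, Finset.mul_sum]
    refine Finset.sum_le_sum fun p _ => ?_
    rw [lintegral_indicator_const Metric.isClosed_closedBall.measurableSet, vol p hρX, mul_comm]
  rw [← ENNReal.pow_le_pow_left_iff two_ne_zero, mul_pow, ← ENNReal.ofReal_pow (by positivity),
    mul_pow, Real.sq_sqrt (by positivity)]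
  calc eLpNorm (localizedFourier X Y h f) 2 volume ^ 2
      ≤ ENNReal.ofReal vX * ENNReal.ofReal (a ^ 2 * ∑ p ∈ P, M p ^ 2) := output
    _ ≤ ENNReal.ofReal vX * ENNReal.ofReal (a ^ 2 *
          (K * ∑ q ∈ Q, (∫ y in c ⁻¹' {q}, ‖g y‖) ^ 2)) := by gcongr
    _ = ENNReal.ofReal (vX * (a ^ 2 * K)) *
          ENNReal.ofReal (∑ q ∈ Q, (∫ y in c ⁻¹' {q}, ‖g y‖) ^ 2) := by
        rw [← ENNReal.ofReal_mul vX0, ← ENNReal.ofReal_mul (by positivity)]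
        congr 1
        ring
    _ ≤ ENNReal.ofReal (vX * (a ^ 2 * K)) *
          (ENNReal.ofReal vY * eLpNorm f 2 volume ^ 2) := by gcongr
    _ = ENNReal.ofReal (a ^ 2 * (vX * vY * K)) * eLpNorm f 2 volume ^ 2 := by
        rw [← mul_assoc, ← ENNReal.ofReal_mul (by positivity)]
        congr 2
        ring

/-! ### Bounds at the finest scale and the volume bound -/

/-- The outcome of the induction on scales: an `ℓ²` bound for superpositions of slowly modulated
waves, which improves on the trivial one by a factor exponentially small in the number of scales. -/
theorem exists_sum_wave_bound {d : ℕ} {X Y : Set (E d)} {h cN κ Z L t s lam : ℝ} {N : ℕ}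
    (TX : RegularTree X t L lam N) (TY : RegularTree Y s L lam N) (hlam : 0 < lam)
    (hlam1 : lam ≤ 1) (hc : 0 < cN) (hc1 : cN ≤ 1)
    (hκ : κ = cN / 100) (hZ : Z = 128 / cN) (hL : 16 * Z + 48 ≤ L) (hh : 0 < h)
    (ht : h ≤ t) (hs : h ≤ s) (htN : t * L ^ N ≤ 1) (hsN : s * L ^ N ≤ 1)
    (hno : IsNonorthogonal dot X Y cN h h 1 1)
    (hts : t * L ^ N * s = κ * h) {WX WY wX wY v : ℝ} (hwX : 0 < wX) (hwY : 0 < wY) (hv : 0 < v)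
    (hWX : ∑ p ∈ TX.node N, TX.weight N p ≤ WX) (hWY : ∑ q ∈ TY.node N, TY.weight N q ≤ WY)
    (hX0 : ∀ p ∈ TX.node 0, wX ≤ TX.weight 0 p) (hY0 : ∀ q ∈ TY.node 0, wY ≤ TY.weight 0 q)
    (hYN : ∀ q ∈ TY.node N, v ≤ TY.weight N q)
    (F : E d → E d → ℂ) (c : E d → ℝ)
    (hF : ∀ q ∈ TY.node 0, AmplitudeBound (F q) Set.univ (2 * s / h) (c q)) :
    ∃ M : E d → ℝ,
      (∀ p ∈ TX.node 0, ∀ x ∈ Metric.closedBall p (2 * t),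
        ‖∑ q ∈ TY.node 0, wave h q x * F q x‖ ≤ M p) ∧
      ∑ p ∈ TX.node 0, M p ^ 2 ≤
        (WX * WY ^ 2 / (wX * wY * v) * (1 - (κ / 8) ^ 2 * lam ^ 2 / 2) ^ N) *
          ∑ q ∈ TY.node 0, c q ^ 2 := by
  obtain ⟨G, M, A, hA0, hsum, hA, hM, hmass⟩ := exists_bounds_at_level TX TY hlam hlam1 hc hc1 hκ
    hZ hL hh ht hs htN hsN hno hts F c hF N le_rfl
  rw [Nat.sub_self, pow_zero, mul_one] at hM
  rw [Nat.sub_self] at hmass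
  have hκ0 : 0 < κ := by rw [hκ]; positivity
  have hκ1 : κ ≤ 1 / 100 := by rw [hκ]; linarith
  have hρ : 0 ≤ 1 - (κ / 8) ^ 2 * lam ^ 2 / 2 := by
    have h1 : (κ / 8) ^ 2 ≤ 1 := by nlinarith
    have h2 : lam ^ 2 ≤ 1 := by nlinarith
    have h3 : (κ / 8) ^ 2 * lam ^ 2 ≤ 1 := mul_le_one₀ h1 (by positivity) h2
    linarith
  set ρ := 1 - (κ / 8) ^ 2 * lam ^ 2 / 2
  have wXnn : ∀ p ∈ TX.node N, 0 ≤ TX.weight N p := fun p hp => (TX.weight_pos N le_rfl p hp).le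
  have wYnn : ∀ q ∈ TY.node N, 0 ≤ TY.weight N q := fun q hq => (TY.weight_pos N le_rfl q hq).le
  have WX0 : 0 ≤ WX := (Finset.sum_nonneg wXnn).trans hWX
  have WY0 : 0 ≤ WY := (Finset.sum_nonneg wYnn).trans hWY
  refine ⟨fun p => ∑ q ∈ TY.node N, M p q, fun p hp x hx => ?_, ?_⟩
  · rw [← hsum x]
    refine (norm_sum_le _ _).trans (Finset.sum_le_sum fun q hq => ?_)
    rw [norm_mul, norm_wave, one_mul]
    exact (hM q hq p hp).norm_le x hx
  · have card : ((TY.node N).card : ℝ) ≤ WY / v := by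
      rw [le_div_iff₀ hv, ← nsmul_eq_mul]
      exact (Finset.card_nsmul_le_sum _ _ _ hYN).trans hWY
    calc ∑ p ∈ TX.node 0, (∑ q ∈ TY.node N, M p q) ^ 2
        ≤ ∑ p ∈ TX.node 0, TX.weight 0 p / wX * (WY / v * ∑ q ∈ TY.node N, M p q ^ 2) := by
          refine Finset.sum_le_sum fun p hp => ?_
          have h1 : 1 ≤ TX.weight 0 p / wX := by rw [one_le_div hwX]; exact hX0 p hp
          have h2 : 0 ≤ ∑ q ∈ TY.node N, M p q ^ 2 := Finset.sum_nonneg fun _ _ => sq_nonneg _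
          have h3 : 0 ≤ WY / v := by positivity
          refine (sq_sum_le_card_mul_sum_sq).trans ?_
          refine le_trans ?_ (le_mul_of_one_le_left (by positivity) h1)
          gcongr
      _ = WY / v / wX * ∑ q ∈ TY.node N, ∑ p ∈ TX.node 0, TX.weight 0 p * M p q ^ 2 := by
          rw [Finset.sum_comm]
          simp only [Finset.mul_sum]
          refine Finset.sum_congr rfl fun p _ => Finset.sum_congr rfl fun q _ => ?_
          ring
      _ ≤ WY / v / wX * ∑ q ∈ TY.node N, ρ ^ N * WX * (WY * A q) := by
          gcongr with q hq
          refine (hmass q hq).trans ?_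
          have := hA0 q hq
          have := (Finset.single_le_sum wYnn hq).trans hWY
          have := wYnn q hq
          gcongr
      _ = WY / v / wX * (ρ ^ N * WX * WY) * ∑ q ∈ TY.node 0, c q ^ 2 / TY.weight 0 q := by
          rw [← hA]
          simp only [Finset.mul_sum]
          refine Finset.sum_congr rfl fun q _ => ?_
          ring
      _ ≤ WY / v / wX * (ρ ^ N * WX * WY) * ∑ q ∈ TY.node 0, c q ^ 2 / wY := by
          gcongr with q hq
          exact hY0 q hq
      _ = _ := by
          rw [← Finset.sum_div]
          field_simp

theorem l2OpNorm_localizedFourier_le_zero_of_empty {d : ℕ} {X Y : Set (E d)} {h : ℝ}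
    (hXY : X = ∅ ∨ Y = ∅) :
    l2OpNorm (localizedFourier X Y h) ≤ 0 := by
  refine sInf_le fun f _ => ?_
  have : localizedFourier X Y h f = 0 := by
    rcases hXY with rfl | rfl
    · simp [localizedFourier, nbhd, Pi.zero_def]
    · ext x
      have : semiclassicalFourier h ((nbhd (∅ : Set (E d)) h).indicator f) = 0 := by
        ext x
        simp [semiclassicalFourier, nbhd]
      simp [localizedFourier, this]
  simp [this]

theorem nbhd_covered {d : ℕ} {X : Set (E d)} {P : Finset (E d)} {h t : ℝ}
    (hP : ∀ x ∈ X, ∃ a ∈ P, dist x a ≤ t) : ∀ x ∈ nbhd X h, ∃ a ∈ P, dist x a ≤ t + h := by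
  rintro _ ⟨x, hx, v, hv, rfl⟩
  obtain ⟨a, ha, hxa⟩ := hP x hx
  refine ⟨a, ha, ?_⟩
  have : dist (x + v) x < h := by
    rw [dist_eq_norm, add_sub_cancel_left]
    exact mem_ball_zero_iff.1 hv
  linarith [dist_triangle (x + v) x a]

/-- The volume bound for sets of diameter at most `R`, from the covers by a single ball. -/
theorem l2OpNorm_localizedFourier_le_of_diam {d : ℕ} {X Y : Set (E d)} {h R : ℝ} (hh : 0 < h)
    (hh1 : h ≤ 1) (hR : 0 ≤ R) (hX : Bornology.IsBounded X) (hY : Bornology.IsBounded Y)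
    (hXR : Metric.diam X ≤ R) (hYR : Metric.diam Y ≤ R) :
    l2OpNorm (localizedFourier X Y h) ≤ ENNReal.ofReal ((2 * Real.pi * h) ^ (-(d : ℝ) / 2) *
      ((R + 1) ^ d * volume.real (Metric.ball (0 : E d) 1))) := by
  rcases X.eq_empty_or_nonempty with hXe | ⟨x₀, hx₀⟩
  · exact (l2OpNorm_localizedFourier_le_zero_of_empty (Or.inl hXe)).trans zero_le
  rcases Y.eq_empty_or_nonempty with hYe | ⟨y₀, hy₀⟩
  · exact (l2OpNorm_localizedFourier_le_zero_of_empty (Or.inr hYe)).trans zero_le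
  have cov : ∀ {Z : Set (E d)} {z₀ : E d}, z₀ ∈ Z → Bornology.IsBounded Z → Metric.diam Z ≤ R →
      ∀ z ∈ nbhd Z h, ∃ a ∈ ({z₀} : Finset (E d)), dist z a ≤ R + 1 := by
    intro Z z₀ hz₀ hZ hZR z hz
    obtain ⟨a, ha, hza⟩ := nbhd_covered (P := {z₀}) (t := R) (fun z hz => ⟨z₀, by simp,
      (Metric.dist_le_diam_of_mem hZ hz hz₀).trans hZR⟩) z hz
    exact ⟨a, ha, by linarith⟩
  refine (l2OpNorm_localizedFourier_le hh (Finset.singleton_nonempty y₀) (by positivity)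
    (by positivity) (cov hx₀ hX hXR) (cov hy₀ hY hYR) zero_le_one fun F c hF => ?_).trans_eq ?_
  · refine ⟨fun _ => c y₀, fun p _ x _ => ?_, by simp⟩
    rw [Finset.sum_singleton, norm_mul, norm_wave, one_mul]
    exact (hF y₀ (by simp)).norm_le x trivial
  · rw [mul_one, Real.sqrt_mul_self (by positivity)]

/-! ### The fractal uncertainty principle -/

/-- The bound of `l2OpNorm_localizedFourier_le` for balls of radii `8 h` and `2 s`, with `N` steps
that each gain the factor `L ^ (-γ)`, as a power of `h`. -/
theorem volume_bound_mul_decay_le {d : ℕ} {δ δ' h κ L V γ D s : ℝ} {N : ℕ} (hh : 0 < h) (hκ : 0 < κ)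
    (hL : 1 < L) (hV : 0 ≤ V) (hγ : 0 < γ) (hD : 0 ≤ D)
    (hN : κ / (16 * h) < L ^ (N + 1)) (hs : s * L ^ N = κ / 4) :
    (2 * Real.pi * h) ^ (-(d : ℝ) / 2) *
      √(((2 * (4 * h)) ^ d * V) * ((2 * s) ^ d * V) *
        (D * h ^ (-δ - δ') * (L ^ (-γ)) ^ N)) ≤
    (2 * Real.pi) ^ (-(d : ℝ) / 2) * √((64 * L) ^ d * V ^ 2 * D * (L ^ γ * (16 / κ) ^ γ)) *
      h ^ (((d : ℝ) - δ - δ') / 2 + γ / 2) := by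
  have L0 : 0 < L := by linarith
  have decay : (L ^ (-γ)) ^ N ≤ L ^ γ * (16 / κ) ^ γ * h ^ γ := by
    have e : (L ^ (-γ)) ^ N = L ^ γ * (L ^ (N + 1)) ^ (-γ) := by
      rw [← Real.rpow_natCast (L ^ (-γ)), ← Real.rpow_natCast L, ← Real.rpow_mul L0.le,
        ← Real.rpow_mul L0.le, ← Real.rpow_add L0]
      congr 1
      push_cast
      ring
    have h2 : (L ^ (N + 1)) ^ (-γ) ≤ (κ / (16 * h)) ^ (-γ) :=
      Real.rpow_le_rpow_of_nonpos (by positivity) hN.le (by linarith)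
    have h3 : (κ / (16 * h)) ^ (-γ) = (16 / κ) ^ γ * h ^ γ := by
      rw [Real.rpow_neg (by positivity), ← Real.inv_rpow (by positivity),
        ← Real.mul_rpow (by positivity) hh.le]
      congr 1
      field_simp
    rw [e, mul_assoc, ← h3]
    gcongr
  have s0 : 0 < s := by
    by_contra hc
    have := mul_nonpos_of_nonpos_of_nonneg (not_lt.1 hc) (by positivity : 0 ≤ L ^ N)
    linarith
  have s_le : 2 * s ≤ 8 * L * h := by
    rw [div_lt_iff₀ (by positivity)] at hN
    have h1 : s * L ^ N ≤ 4 * L * h * L ^ N := by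
      rw [hs]
      have : L ^ (N + 1) * (16 * h) = 4 * (4 * L * h * L ^ N) := by rw [pow_succ]; ring
      linarith
    have := le_of_mul_le_mul_right h1 (by positivity)
    linarith
  have inside : ((2 * (4 * h)) ^ d * V) * ((2 * s) ^ d * V) *
        (D * h ^ (-δ - δ') * (L ^ (-γ)) ^ N) ≤
      (64 * L) ^ d * V ^ 2 * D * (L ^ γ * (16 / κ) ^ γ) * h ^ (2 * (d : ℝ) - δ - δ' + γ) := by
    calc ((2 * (4 * h)) ^ d * V) * ((2 * s) ^ d * V) * (D * h ^ (-δ - δ') * (L ^ (-γ)) ^ N)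
        ≤ ((2 * (4 * h)) ^ d * V) * ((8 * L * h) ^ d * V) *
          (D * h ^ (-δ - δ') * (L ^ γ * (16 / κ) ^ γ * h ^ γ)) := by gcongr
      _ = (64 * L) ^ d * V ^ 2 * D * (L ^ γ * (16 / κ) ^ γ) *
          (h ^ d * h ^ d * h ^ (-δ - δ') * h ^ γ) := by
        have : (64 * L) ^ d = 8 ^ d * (8 * L) ^ d := by rw [← mul_pow]; ring
        rw [this, show 2 * (4 * h) = 8 * h by ring, mul_pow 8 h, mul_pow (8 * L) h]
        ring
      _ = _ := by
        rw [← Real.rpow_natCast h, ← Real.rpow_add hh, ← Real.rpow_add hh, ← Real.rpow_add hh]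
        congr 2
        ring
  have e1 : (2 * Real.pi * h) ^ (-(d : ℝ) / 2) =
      (2 * Real.pi) ^ (-(d : ℝ) / 2) * h ^ (-(d : ℝ) / 2) :=
    Real.mul_rpow (by positivity) hh.le
  have e2 : √(h ^ (2 * (d : ℝ) - δ - δ' + γ)) = h ^ ((2 * (d : ℝ) - δ - δ' + γ) / 2) := by
    rw [Real.sqrt_eq_rpow, ← Real.rpow_mul hh.le]
    congr 1
    ring
  have e3 : h ^ (((d : ℝ) - δ - δ') / 2 + γ / 2) =
      h ^ (-(d : ℝ) / 2) * h ^ ((2 * (d : ℝ) - δ - δ' + γ) / 2) := by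
    rw [← Real.rpow_add hh]
    congr 1
    ring
  have root := Real.sqrt_le_sqrt inside
  rw [Real.sqrt_mul' _ (Real.rpow_nonneg hh.le (2 * (d : ℝ) - δ - δ' + γ)), e2] at root
  rw [e1, e3]
  calc _ ≤ (2 * Real.pi) ^ (-(d : ℝ) / 2) * h ^ (-(d : ℝ) / 2) *
        (√((64 * L) ^ d * V ^ 2 * D * (L ^ γ * (16 / κ) ^ γ)) *
          h ^ ((2 * (d : ℝ) - δ - δ' + γ) / 2)) := by gcongr
    _ = _ := by ring

/-- The fractal uncertainty principle for `h` so small that there are scales between `h` and `κ`. -/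
theorem exists_bound_of_small (d : ℕ) {δ δ' : ℝ} (hδ' : 0 < δ') {CX CY cN R κ : ℝ}
    (hCX : 1 ≤ CX) (hCY : 1 ≤ CY) (hc : 0 < cN) (hc1 : cN ≤ 1) (hκ : κ = cN / 100) :
    ∃ ε₀ : ℝ, 0 < ε₀ ∧ ∃ C : ℝ, 0 ≤ C ∧
      ∀ h : ℝ, 0 < h → h ≤ κ / 16 → ∀ X Y : Set (E d),
        IsADRegularSet X δ h 1 CX → IsADRegularSet Y δ' h 1 CY →
        IsNonorthogonal dot X Y cN h h 1 1 →
        Metric.diam X ≤ R → Metric.diam Y ≤ R →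
        l2OpNorm (localizedFourier X Y h) ≤
          ENNReal.ofReal (C * h ^ (((d : ℝ) - δ - δ') / 2 + ε₀)) := by
  obtain ⟨Z, hZ⟩ : ∃ Z, Z = 128 / cN := ⟨_, rfl⟩
  obtain ⟨L, hL⟩ : ∃ L, L = 16 * Z + 48 := ⟨_, rfl⟩
  have hZ128 : 128 ≤ Z := by rw [hZ, le_div_iff₀ hc]; linarith
  have hL1 : 1 < L := by linarith
  have L0 : 0 < L := by linarith
  have κ0 : 0 < κ := by rw [hκ]; positivity
  have κ1 : κ ≤ 1 / 100 := by rw [hκ]; linarith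
  obtain ⟨lam, hlam, hlam1, hlX, hlY⟩ : ∃ lam : ℝ, 0 < lam ∧ lam ≤ 1 ∧
      lam ≤ (CX ^ 2 * (8 * L) ^ δ)⁻¹ ∧ lam ≤ (CY ^ 2 * (8 * L) ^ δ')⁻¹ :=
    ⟨min 1 (min (CX ^ 2 * (8 * L) ^ δ)⁻¹ (CY ^ 2 * (8 * L) ^ δ')⁻¹), by positivity,
      min_le_left _ _, (min_le_right _ _).trans (min_le_left _ _),
      (min_le_right _ _).trans (min_le_right _ _)⟩
  -- the gain at each step, written as a power of the ratio of scales
  obtain ⟨γ, hγ, hγρ⟩ : ∃ γ : ℝ, 0 < γ ∧ 1 - (κ / 8) ^ 2 * lam ^ 2 / 2 = L ^ (-γ) := by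
    have h1 : 0 < (κ / 8) ^ 2 * lam ^ 2 / 2 := by positivity
    have h2 : (κ / 8) ^ 2 * lam ^ 2 ≤ 1 :=
      mul_le_one₀ (by nlinarith) (by positivity) (by nlinarith)
    have h3 : 0 < Real.log L := Real.log_pos hL1
    refine ⟨-Real.log (1 - (κ / 8) ^ 2 * lam ^ 2 / 2) / Real.log L,
      div_pos (neg_pos.2 (Real.log_neg (by linarith) (by linarith))) h3, ?_⟩
    rw [Real.rpow_def_of_pos L0, neg_div, neg_neg, mul_div_cancel₀ _ h3.ne',
      Real.exp_log (by linarith)]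
  obtain ⟨n, hn, hmass⟩ := exists_mass_bound d R
  set V := volume.real (Metric.ball (0 : E d) 1) with hVdef
  have V0 : 0 ≤ V := measureReal_nonneg
  set D := n * CX * (n * CY) ^ 2 / (CX⁻¹ * CY⁻¹ * (CY⁻¹ * (κ / 16) ^ δ')) with hD
  have D0 : 0 ≤ D := by positivity
  refine ⟨γ / 2, by positivity,
    (2 * Real.pi) ^ (-(d : ℝ) / 2) * √((64 * L) ^ d * V ^ 2 * D * (L ^ γ * (16 / κ) ^ γ)),
    by positivity, ?_⟩
  rintro h hh hhκ X Y ⟨μ, hμ, rfl⟩ ⟨ν, hν, rfl⟩ hno hXR hYR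
  rcases μ.support.eq_empty_or_nonempty with hXe | hXne
  · exact (l2OpNorm_localizedFourier_le_zero_of_empty (Or.inl hXe)).trans zero_le
  rcases ν.support.eq_empty_or_nonempty with hYe | hYne
  · exact (l2OpNorm_localizedFourier_le_zero_of_empty (Or.inr hYe)).trans zero_le
  have hh1 : h ≤ 1 := by linarith
  -- The scales are `4 h, …, 4 h L ^ N` in `X` and `s, …, s L ^ N = κ / 4` in `Y`. The choice of `s`
  -- makes `(4 h L ^ N) s = κ h`, and maximality of `N` puts `s` between `4 h` and `4 L h`.
  obtain ⟨N, hN, hN'⟩ := exists_nat_pow_near (x := κ / (16 * h)) (y := L)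
    (by rw [le_div_iff₀ (by positivity)]; linarith) hL1
  have LN0 : 0 < L ^ N := by positivity
  obtain ⟨s, hs⟩ : ∃ s, s * L ^ N = κ / 4 := ⟨κ / 4 / L ^ N, by field_simp⟩
  have tN : 4 * h * L ^ N ≤ κ / 4 := by
    rw [le_div_iff₀ (by positivity)] at hN
    linarith
  have hs4 : 4 * h ≤ s := le_of_mul_le_mul_right (tN.trans_eq hs.symm) LN0
  have s0 : 0 < s := by linarith
  obtain ⟨TX, covX, lowX, massX⟩ := hμ.exists_regularTree hXne (t := 4 * h) (L := L) (N := N) hh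
    le_rfl (by linarith) (by linarith) hlX
  obtain ⟨TY, covY, lowY, massY⟩ := hν.exists_regularTree hYne (t := s) (L := L) (N := N) hh
    hs4 (by linarith) (by linarith) hlY
  have low0X : ∀ p ∈ TX.node 0, CX⁻¹ * h ^ δ ≤ TX.weight 0 p := fun p hp => by
    have := lowX 0 (Nat.zero_le _) p hp
    rwa [pow_zero, mul_one, mul_div_cancel_left₀ _ (four_ne_zero)] at this
  have low0Y : ∀ q ∈ TY.node 0, CY⁻¹ * h ^ δ' ≤ TY.weight 0 q := fun q hq => by
    refine le_trans ?_ (lowY 0 (Nat.zero_le _) q hq)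
    rw [pow_zero, mul_one]
    gcongr
    linarith
  have lowNY : ∀ q ∈ TY.node N, CY⁻¹ * (κ / 16) ^ δ' ≤ TY.weight N q := fun q hq => by
    have := lowY N le_rfl q hq
    rwa [hs, div_div, show (4 : ℝ) * 4 = 16 by norm_num] at this
  have coverX : ∀ x ∈ nbhd μ.support h, ∃ p ∈ TX.node 0, dist x p ≤ 2 * (4 * h) := fun x hx => by
    obtain ⟨p, hp, hxp⟩ := nbhd_covered covX x hx
    exact ⟨p, hp, by linarith⟩
  have coverY : ∀ y ∈ nbhd ν.support h, ∃ q ∈ TY.node 0, dist y q ≤ 2 * s := fun y hy => by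
    obtain ⟨q, hq, hyq⟩ := nbhd_covered covY y hy
    exact ⟨q, hq, by linarith⟩
  have Qne : (TY.node 0).Nonempty := by
    obtain ⟨y, hy⟩ := hYne
    obtain ⟨q, hq, -⟩ := covY y hy
    exact ⟨q, hq⟩
  have hpow : 0 < h ^ δ := Real.rpow_pos_of_pos hh _
  have hpow' : 0 < h ^ δ' := Real.rpow_pos_of_pos hh _
  refine (l2OpNorm_localizedFourier_le hh Qne (by positivity) (by positivity) coverX coverY
    (K := D * h ^ (-δ - δ') * (L ^ (-γ)) ^ N) (by positivity) fun F c hF => ?_).trans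
    (ENNReal.ofReal_le_ofReal (volume_bound_mul_decay_le hh κ0 hL1 V0 hγ D0 hN' hs))
  obtain ⟨M, hM, hMsum⟩ := exists_sum_wave_bound TX TY hlam hlam1 hc hc1 hκ hZ hL.ge hh
    (by linarith) (by linarith) (by linarith) (by linarith) hno
    (by rw [mul_assoc (4 * h), mul_comm (L ^ N), hs]; ring)
    (wX := CX⁻¹ * h ^ δ) (wY := CY⁻¹ * h ^ δ') (v := CY⁻¹ * (κ / 16) ^ δ')
    (by positivity) (by positivity) (by positivity)
    ((massX N).trans (hmass μ δ h CX hμ hh1 hXR)) ((massY N).trans (hmass ν δ' h CY hν hh1 hYR))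
    low0X low0Y lowNY F c hF
  refine ⟨M, hM, hMsum.trans_eq ?_⟩
  have e : h ^ (-δ - δ') = (h ^ δ)⁻¹ * (h ^ δ')⁻¹ := by
    rw [← Real.rpow_neg hh.le, ← Real.rpow_neg hh.le, ← Real.rpow_add hh]
    congr 1
  rw [hγρ, hD, e]
  congr 2
  generalize (κ / 16) ^ δ' = u at *
  field_simp

end FUP

theorem corollary1p4 (d : ℕ) (δ δ' : ℝ) (hδ : 0 < δ) (hδd : δ < d) (hδ' : 0 < δ') (hδd' : δ' < d)
    (CX CY cN R : ℝ) :
    ∃ ε₀ : ℝ, 0 < ε₀ ∧ ∃ C : ℝ, 0 < C ∧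
      ∀ h : ℝ, 0 < h → h ≤ 1 → ∀ X Y : Set (FUP.E d),
        FUP.IsADRegularSet X δ h 1 CX → FUP.IsADRegularSet Y δ' h 1 CY →
        FUP.IsNonorthogonal FUP.dot X Y cN h h 1 1 →
        Metric.diam X ≤ R → Metric.diam Y ≤ R →
        FUP.l2OpNorm (FUP.localizedFourier X Y h) ≤
          ENNReal.ofReal (C * h ^ (((d : ℝ) - δ - δ') / 2 + ε₀)) := by
  -- outside this range of parameters no pair `(X, Y)` satisfies the hypotheses
  by_cases hpar : 1 ≤ CX ∧ 1 ≤ CY ∧ 0 < cN ∧ cN ≤ 1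
  swap
  · refine ⟨1, one_pos, 1, one_pos, ?_⟩
    rintro h - - X Y ⟨μ, hμ, -⟩ ⟨ν, hν, -⟩ hno - -
    exact absurd ⟨hμ.one_le_const, hν.one_le_const, hno.1, hno.2.1⟩ hpar
  obtain ⟨hCX, hCY, hc, hc1⟩ := hpar
  obtain ⟨ε₀, hε₀, C, hC, small⟩ := FUP.exists_bound_of_small d hδ' (R := R) hCX hCY hc hc1 rfl
  set e := ((d : ℝ) - δ - δ') / 2 + ε₀
  set h₀ := cN / 100 / 16
  have h₀pos : 0 < h₀ := by positivity
  set B := (2 * Real.pi * h₀) ^ (-(d : ℝ) / 2) *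
      ((max R 0 + 1) ^ d * volume.real (Metric.ball (0 : FUP.E d) 1)) with hB
  have B0 : 0 ≤ B := by positivity
  refine ⟨ε₀, hε₀, C + B / h₀ ^ |e| + 1, by positivity, ?_⟩
  intro h hh hh1 X Y hX hY hno hXR hYR
  have he : 0 < h ^ e := Real.rpow_pos_of_pos hh _
  have pow0 : 0 < h₀ ^ |e| := Real.rpow_pos_of_pos h₀pos _
  have hBd : 0 ≤ B / h₀ ^ |e| := by positivity
  rcases le_total h h₀ with hsmall | hlarge
  · refine (small h hh hsmall X Y hX hY hno hXR hYR).trans (ENNReal.ofReal_le_ofReal ?_)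
    gcongr
    linarith
  · obtain ⟨μ, hμ, rfl⟩ := hX
    obtain ⟨ν, hν, rfl⟩ := hY
    refine (FUP.l2OpNorm_localizedFourier_le_of_diam hh hh1 (le_max_right R 0)
      hμ.isCompact_support.isBounded hν.isCompact_support.isBounded (hXR.trans (le_max_left _ _))
      (hYR.trans (le_max_left _ _))).trans (ENNReal.ofReal_le_ofReal ?_)
    have h1 : (2 * Real.pi * h) ^ (-(d : ℝ) / 2) ≤ (2 * Real.pi * h₀) ^ (-(d : ℝ) / 2) := by
      refine Real.rpow_le_rpow_of_nonpos (by positivity) (by gcongr) ?_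
      have : (0 : ℝ) ≤ d := Nat.cast_nonneg d
      linarith
    have h2 : h₀ ^ |e| ≤ h ^ e :=
      (Real.rpow_le_rpow h₀pos.le hlarge (abs_nonneg e)).trans
        (Real.rpow_le_rpow_of_exponent_ge hh hh1 (le_abs_self e))
    calc _ ≤ B := by
          rw [hB]
          gcongr
      _ = B / h₀ ^ |e| * h₀ ^ |e| := by field_simp
      _ ≤ B / h₀ ^ |e| * h ^ e := by gcongr
      _ ≤ _ := by
          gcongr
          linarith
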